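/- Let $g',g\ge 1$ and $d',d\ge 0$ be integers. For $X=(X_{ij})\in(\mathbb C^{n\times n})^{g'\times g}$ let $\|X\|$ be the operator norm of the $g'n\times gn$ matrix $X$. An NC map $f$ from $g'\times g$ tuples to $d'\times d$ tuples consists of maps $X\mapsto f(X)\in(\mathbb C^{n\times n})^{d'\times d}$, for all $n$, for $X\in(\mathbb C^{n\times n})^{g'\times g}$ with $\|X\|<1$. It is NC analytic (on the ball) if (1) there are $\varepsilon>0$ and coefficients $a_w\in\mathbb C^{d'\times d}$, indexed by the words $w$ in the letters $x_{ij}$ ($1\le i\le g'$, $1\le j\le g$), such that $f(X)=\sum_{m=0}^\infty\sum_{|w|=m}a_w\otimes w(X)$ converges for all $n$ and all $X$ with $\|X\|<\min(\varepsilon,1)$; and (2) for every analytic map $\alpha$ from a domain $W\subseteq\mathbb C^N$ into the $n\times n$ level of the open ball $\{\|X\|<1\}$, $f\circ\alpha$ is analytic on $W$, and it is continuous on $\overline W$ if $\alpha$ is continuous on $\overline W$ with values in the open ball there. It is contraction-valued if $\|f(X)\|\le1$ whenever $\|X\|<1$. An NC ball map is an NC analytic, contraction-valued $f$ that maps the boundary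 to the boundary: whenever $\|X\|=1$, $t\in\mathbb R$ and $\lim_{r\nearrow1}f(re^{it}X)$ exists, this limit has norm $1$. By $f(0)\in\mathbb C^{d'\times d}$ we mean the value at the zero tuple of $1\times1$ matrices. For $v\in\mathbb C^{d'\times d}$ with $\|v\|<1$ put $$\mathscr F_v(u)=v-(I_{d'}-vv^*)^{1/2}\,u\,(I_d-v^*u)^{-1}(I_d-v^*v)^{1/2},$$ where at level $n$ a scalar matrix $A$ stands for $A\otimes I_n$. **Theorem.** (a) Let $f$ be an NC ball map from $g'\times g$ tuples to $d'\times d$ tuples with $\|f(0)\|\ne1$. Then there is an NC map $\varphi$ such that, for all $X$ with $\|X\|<1$, $$f(X)=\mathscr F_{f(0)}(\varphi(X)),\qquad \varphi(X)=\mathscr F_{f(0)}(f(X))=V\begin{bmatrix}X&0\\0&\tilde\varphi(X)\end{bmatrix}U^*,$$ where $g'\le d'$, $g\le d$, $U\in\mathbb C^{d\times d}$ and $V\in\mathbb C^{d'\times d'}$ are unitary, and $\tilde\varphi$ is an NC analytic contraction-valued map from $g'\times g$ tuples to $(d'-g')\times(d-g)$ tuples with $\|\tilde\varphi(0)\|<1$.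 (b) Conversely, let $g'\le d'$, $g\le d$, let $v\in\mathbb C^{d'\times d}$ with $\|v\|<1$, let $U\in\mathbb C^{d\times d}$ and $V\in\mathbb C^{d'\times d'}$ be unitary, and let $\tilde\varphi$ be an NC analytic contraction-valued map from $g'\times g$ tuples to $(d'-g')\times(d-g)$ tuples with $\|\tilde\varphi(0)\|<1$. Then every $f$ with $$f(X)=\mathscr F_v\left(V\begin{bmatrix}X&0\\0&\tilde\varphi(X)\end{bmatrix}U^*\right)\qquad(\|X\|<1)$$ is an NC ball map with $\|f(0)\|\ne1$. In particular this holds for $v=f(0)$, that is, for every $f$ with $\|f(0)\|<1$ satisfying the equations in (a). -/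

import Mathlib

open scoped Matrix.Norms.L2Operator MatrixOrder ComplexOrder Kronecker Topology
open Filter

noncomputable section

/-- `p × q` block matrices whose entries are `n × n` complex matrices; the first index is the block
index. With the scoped instances above, `‖X‖` is the operator norm of the `pn × qn` matrix `X`. -/
abbrev NCMat (p q n : ℕ) : Type := Matrix (Fin p × Fin n) (Fin q × Fin n) ℂ

/-- A graded map sending `p × q` tuples of `n × n` matrices to `r × s` tuples of `n × n` matrices,
for every `n`. Only its values on the NC domain under consideration are ever used. -/
abbrev NCMap (p q r s : ℕ) : Type := (n : ℕ) → NCMat p q n → NCMat r s n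

namespace NCMat

/-- The `n × n` entry of `X` at the block position `k = (i, j)`. -/
def entry {p q n : ℕ} (X : NCMat p q n) (k : Fin p × Fin q) : Matrix (Fin n) (Fin n) ℂ :=
  Matrix.of fun a b => X (k.1, a) (k.2, b)

/-- The evaluation `w(X)` of a word `w` in the letters `x_{ij}`. -/
def word {p q n : ℕ} (X : NCMat p q n) (w : List (Fin p × Fin q)) : Matrix (Fin n) (Fin n) ℂ :=
  (w.map X.entry).prod

/-- A scalar matrix `A`, regarded as the constant `A ⊗ I_n` at level `n`. -/
def const {r s : ℕ} (A : Matrix (Fin r) (Fin s) ℂ) (n : ℕ) : NCMat r s n :=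
  A ⊗ₖ (1 : Matrix (Fin n) (Fin n) ℂ)

/-- The identification of the row (or column) indices of a two by two block decomposition
`p + (r - p) = r`, at level `n`. -/
def splitEquiv {p r : ℕ} (h : p ≤ r) (n : ℕ) :
    (Fin p × Fin n) ⊕ (Fin (r - p) × Fin n) ≃ Fin r × Fin n :=
  (Equiv.sumProdDistrib (Fin p) (Fin (r - p)) (Fin n)).symm.trans
    (Equiv.prodCongr (finSumFinEquiv.trans (finCongr (Nat.add_sub_of_le h))) (Equiv.refl (Fin n)))

/-- The block diagonal matrix with the diagonal blocks `X` and `Y`. -/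
def blockDiag {p q r s n : ℕ} (hr : p ≤ r) (hs : q ≤ s)
    (X : NCMat p q n) (Y : NCMat (r - p) (s - q) n) : NCMat r s n :=
  Matrix.reindex (splitEquiv hr n) (splitEquiv hs n) (Matrix.fromBlocks X 0 0 Y)

end NCMat

/-- The homogeneous part of degree `m` of the NC power series `∑ a_w w`, evaluated at `X`:
the sum of `a_w ⊗ w(X)` over all words `w` of length `m`. -/
def ncHomPart {p q r s n : ℕ} (a : List (Fin p × Fin q) → Matrix (Fin r) (Fin s) ℂ) (m : ℕ)
    (X : NCMat p q n) : NCMat r s n :=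
  ∑ w : Fin m → Fin p × Fin q, a (List.ofFn w) ⊗ₖ X.word (List.ofFn w)

/-- The level `n` part of the interior of the NC ball, `{X | ‖X‖ < 1}`. -/
def ncOpenBall (p q n : ℕ) : Set (NCMat p q n) := {X | ‖X‖ < 1}

/-- NC analytic maps on an open NC domain `D` containing `0`. -/
structure IsNCAnalyticOn {p q r s : ℕ} (D : (n : ℕ) → Set (NCMat p q n)) (f : NCMap p q r s) :
    Prop where
  /-- On an NC `ε`-neighborhood of `0`, with `ε` independent of the level, the map is the sum of an
  NC power series, summed over its homogeneous parts. -/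
  powerSeries : ∃ a : List (Fin p × Fin q) → Matrix (Fin r) (Fin s) ℂ, ∃ ε : ℝ, 0 < ε ∧
    ∀ (n : ℕ) (X : NCMat p q n), X ∈ D n → ‖X‖ < ε →
      Tendsto (fun M : ℕ => ∑ m ∈ Finset.range M, ncHomPart a m X) atTop (𝓝 (f n X))
  /-- Substituting an analytic matrix valued map `α : W → D`, for a domain `W` in `ℂ^N`, gives an
  analytic map on `W`, continuous up to the boundary of `W` if `α` is so as a map into `D`. -/
  comp_analytic : ∀ (N n : ℕ) (W : Set (Fin N → ℂ)) (α : (Fin N → ℂ) → NCMat p q n),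
    IsOpen W → IsConnected W → DifferentiableOn ℂ α W → Set.MapsTo α W (D n) →
      DifferentiableOn ℂ (fun z => f n (α z)) W ∧
      (ContinuousOn α (closure W) → Set.MapsTo α (closure W) (D n) →
        ContinuousOn (fun z => f n (α z)) (closure W))

/-- NC analytic maps on the (interior of the) NC ball of `p × q` tuples. -/
def IsNCAnalyticOnBall {p q r s : ℕ} (f : NCMap p q r s) : Prop :=
  IsNCAnalyticOn (fun n => ncOpenBall p q n) f

/-- `f` maps the interior of the NC ball into the closed NC ball. -/
def IsContractionValued {p q r s : ℕ} (f : NCMap p q r s) : Prop :=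
  ∀ (n : ℕ) (X : NCMat p q n), ‖X‖ < 1 → ‖f n X‖ ≤ 1

/-- `f` maps the boundary to the boundary: if `‖X‖ = 1` and the radial limit
`f(e^{it} X) = lim_{r ↗ 1} f(r e^{it} X)` exists, then this limit has norm one. -/
def MapsBoundaryToBoundary {p q r s : ℕ} (f : NCMap p q r s) : Prop :=
  ∀ (n : ℕ) (X : NCMat p q n) (t : ℝ) (L : NCMat r s n), ‖X‖ = 1 →
    Tendsto (fun ρ : ℝ => f n (((ρ : ℂ) * Complex.exp (t * Complex.I)) • X)) (𝓝[<] (1 : ℝ)) (𝓝 L) →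
    ‖L‖ = 1

/-- NC ball maps: NC analytic maps from the NC ball to the NC ball mapping the boundary to the
boundary. -/
structure IsNCBallMap {p q r s : ℕ} (f : NCMap p q r s) : Prop where
  analytic : IsNCAnalyticOnBall f
  contraction : IsContractionValued f
  boundary : MapsBoundaryToBoundary f

/-- The value `f(0)`, a scalar `r × s` matrix: the value of `f` at the zero tuple of `1 × 1`
matrices. -/
def ncValueZero {p q r s : ℕ} (f : NCMap p q r s) : Matrix (Fin r) (Fin s) ℂ :=
  Matrix.of fun i j => f 1 0 (i, 0) (j, 0)

/-- The linear fractional map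
`u ↦ v - (I - v v^*)^{1/2} u (I - v^* u)^{-1} (I - v^* v)^{1/2}` of the NC ball,
for a scalar matrix `v` with `‖v‖ < 1`, evaluated at level `n`. -/
def linFrac {r s : ℕ} (v : Matrix (Fin r) (Fin s) ℂ) {n : ℕ} (u : NCMat r s n) : NCMat r s n :=
  NCMat.const v n -
    NCMat.const (CFC.sqrt (1 - v * v.conjTranspose)) n * u *
      (1 - NCMat.const v.conjTranspose n * u)⁻¹ *
      NCMat.const (CFC.sqrt (1 - v.conjTranspose * v)) n

end

/-!
The proof of the forward direction passes from an NC ball map `f` to `φ = F_v ∘ f`, where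
`v = f(0)`, which is again NC analytic and contraction valued and has `φ(0) = 0`.

* The Möbius map `F_v` is given by the unitary matrix `[[v, D], [D', -v^*]]` with
  `D = (1 - v v^*)^{1/2}` and `D' = (1 - v^* v)^{1/2}`: it sends `(h, -u x h)` to
  `(F_v(u) h, x h)` with `x` invertible. Hence `F_v` is an involution of the closed ball that
  preserves the open ball (`IsDefectPair.norm_moebius_lt`, `IsDefectPair.moebius_moebius`), and
  so does not change whether the norm of a contraction is one.
* Along complex lines through `0`, NC power series are Taylor series of functions on discs. So for
  a contraction valued map the series converges on the whole ball (`exists_isSchurSeries`), and a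
  recursion for the Taylor coefficients of `f (1 - v^* f)⁻¹` shows that they are homogeneous NC
  polynomials (`IsNCAnalyticOnBall.linFrac_comp`).
* At a nilpotent tuple of order two and norm one, `φ` is linear on the complex line, `f` has a
  radial limit there, and the boundary hypothesis says that the linear part `φ₁` of `φ` has norm
  one (`IsNCBallMap.norm_linearPart_eq_one`). A single such tuple, the rank one tuple of matrix
  units, suffices: a vector at which `φ₁` attains its norm yields, by the equality case of the
  Cauchy–Schwarz inequality, isometries `J` and `J'` with `φ₁(X) J = J' X` and
  `φ₁(X)^* J' = J X^*` (`IsSchurSeries.exists_isometries`).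
* These identities pass from `φ₁` to `φ` (`IsSchurSeries.mul_const_eq`): a contraction `X` is the
  corner of a column `Y` that is isometric on the domain of `X`, and for a unit vector `ξ` in this
  domain the function `z ↦ φ(z Y) J ξ` attains equality in the Schwarz lemma, so it is linear.
  The statement for the rows is the one for the columns of `X ↦ φ(X^*)^*`. Completing `J` and `J'`
  to unitary matrices `U` and `V` gives the block form.

For the converse, if `f = F_v ∘ u` with `u` in block form and `f` has a radial limit `L` at a
boundary point, then `u = F_v ∘ f` has the radial limit `F_v(L)`, whose norm is at least that of
the block `X`, that is one; hence `‖L‖ = 1`.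
-/

set_option linter.unusedSectionVars false

/-! ### Matrices as operators between Euclidean spaces -/

section MatrixNorm

variable {α β γ : Type*} [Fintype α] [DecidableEq α] [Fintype β] [DecidableEq β]
  [Fintype γ] [DecidableEq γ]

/-- The operator between Euclidean spaces given by a matrix; its norm is by definition the
norm of the matrix. -/
noncomputable abbrev Matrix.act :
    Matrix α β ℂ ≃ₗ[ℂ] (EuclideanSpace ℂ β →L[ℂ] EuclideanSpace ℂ α) :=
  (Matrix.toEuclideanLin (𝕜 := ℂ) (m := α) (n := β)).trans LinearMap.toContinuousLinearMap

open Matrix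

lemma act_apply (A : Matrix α β ℂ) (x : EuclideanSpace ℂ β) (i : α) :
    act A x i = ∑ j, A i j * x j := rfl

lemma act_mul (A : Matrix α β ℂ) (B : Matrix β γ ℂ) (x : EuclideanSpace ℂ γ) :
    act (A * B) x = act A (act B x) :=
  congr(WithLp.toLp 2 ($(Matrix.toLin'_mul A B) x))

lemma act_one (x : EuclideanSpace ℂ α) : act (1 : Matrix α α ℂ) x = x := by
  ext i
  simp

lemma inner_act_left (A : Matrix α β ℂ) (x : EuclideanSpace ℂ β) (y : EuclideanSpace ℂ α) :
    inner ℂ (act A x) y = inner ℂ x (act Aᴴ y) := by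
  have h := Matrix.toEuclideanLin_conjTranspose_eq_adjoint A
  change inner ℂ (toEuclideanLin A x) y = inner ℂ x (toEuclideanLin Aᴴ y)
  rw [h, LinearMap.adjoint_inner_right]

lemma norm_act_le (A : Matrix α β ℂ) (x : EuclideanSpace ℂ β) : ‖act A x‖ ≤ ‖A‖ * ‖x‖ :=
  (act A).le_opNorm x

lemma norm_le_of_norm_act_le {A : Matrix α β ℂ} {c : ℝ} (hc : 0 ≤ c)
    (h : ∀ x, ‖act A x‖ ≤ c * ‖x‖) : ‖A‖ ≤ c :=
  (act A).opNorm_le_bound hc h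

lemma norm_act_sq (A : Matrix α β ℂ) (x : EuclideanSpace ℂ β) :
    ‖act A x‖ ^ 2 = (inner ℂ x (act (Aᴴ * A) x)).re := by
  rw [act_mul, ← inner_act_left, inner_self_eq_norm_sq_to_K]
  norm_cast

lemma norm_act_of_isometry {A : Matrix α β ℂ} (h : Aᴴ * A = 1) (x : EuclideanSpace ℂ β) :
    ‖act A x‖ = ‖x‖ := by
  have h1 := norm_act_sq A x
  rw [h, act_one, inner_self_eq_norm_sq_to_K] at h1
  norm_cast at h1
  exact (sq_eq_sq₀ (norm_nonneg _) (norm_nonneg _)).1 h1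

lemma norm_le_one_of_isometry {A : Matrix α β ℂ} (h : Aᴴ * A = 1) : ‖A‖ ≤ 1 :=
  norm_le_of_norm_act_le zero_le_one fun x => by rw [norm_act_of_isometry h, one_mul]

lemma exists_norm_act_eq [Nonempty β] (A : Matrix α β ℂ) :
    ∃ x : EuclideanSpace ℂ β, ‖x‖ = 1 ∧ ‖act A x‖ = ‖A‖ := by
  have hne : (Metric.sphere (0 : EuclideanSpace ℂ β) 1).Nonempty :=
    NormedSpace.sphere_nonempty.2 zero_le_one
  obtain ⟨x, hx, hmax⟩ := (isCompact_sphere (0 : EuclideanSpace ℂ β) 1).exists_isMaxOn hne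
    (act A).continuous.norm.continuousOn
  have hx1 : ‖x‖ = 1 := by simpa using hx
  refine ⟨x, hx1, le_antisymm ?_ ?_⟩
  · simpa [hx1] using norm_act_le A x
  · refine norm_le_of_norm_act_le (norm_nonneg _) fun y => ?_
    rcases eq_or_ne y 0 with rfl | hy
    · simp
    have hy' : 0 < ‖y‖ := norm_pos_iff.2 hy
    have h := hmax (show ((‖y‖⁻¹ : ℝ) : ℂ) • y ∈ Metric.sphere (0 : EuclideanSpace ℂ β) 1 by
      simp [norm_smul, hy'.ne'])
    simp only [Set.mem_ofPred_eq, map_smul, norm_smul, Complex.norm_real, norm_inv, norm_norm] at h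
    rwa [inv_mul_le_iff₀ hy', mul_comm] at h

lemma isUnit_one_sub_mul {a : Matrix α β ℂ} {u : Matrix α β ℂ} (ha : ‖a‖ < 1) (hu : ‖u‖ ≤ 1) :
    IsUnit (1 - aᴴ * u) := by
  refine isUnit_one_sub_of_norm_lt_one ((l2_opNorm_mul _ _).trans_lt ?_)
  rw [l2_opNorm_conjTranspose]
  nlinarith [norm_nonneg a, norm_nonneg u]

lemma one_sub_conjTranspose_mul_self_nonneg {v : Matrix α β ℂ} (hv : ‖v‖ ≤ 1) :
    0 ≤ 1 - vᴴ * v := by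
  rw [sub_nonneg]
  apply (CStarAlgebra.norm_le_one_iff_of_nonneg (vᴴ * v) _).1
  · rw [l2_opNorm_conjTranspose_mul_self]
    nlinarith [norm_nonneg v]
  · exact (Matrix.posSemidef_conjTranspose_mul_self v).nonneg

end MatrixNorm

/-! ### Möbius maps of the matrix ball -/

section Moebius

open Matrix

variable {α β : Type*} [Fintype α] [DecidableEq α] [Fintype β] [DecidableEq β]

/-- The defect operators `D = (1 - a a^*)^{1/2}` and `D' = (1 - a^* a)^{1/2}` of a strict
contraction `a`, recorded by the relations that make `[[a, D], [D', -a^*]]` unitary. -/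
structure IsDefectPair (a : Matrix α β ℂ) (D : Matrix α α ℂ) (D' : Matrix β β ℂ) : Prop where
  norm_lt : ‖a‖ < 1
  left_self : Dᴴ = D
  right_self : D'ᴴ = D'
  left_sq : D * D = 1 - a * aᴴ
  right_sq : D' * D' = 1 - aᴴ * a
  comm : a * D' = D * a

/-- The linear fractional map of the matrix ball with parameter `a` and defect operators
`D`, `D'`. -/
noncomputable def moebius (a : Matrix α β ℂ) (D : Matrix α α ℂ) (D' : Matrix β β ℂ)
    (u : Matrix α β ℂ) : Matrix α β ℂ :=
  a - D * u * (1 - aᴴ * u)⁻¹ * D'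

namespace IsDefectPair

variable {a : Matrix α β ℂ} {D : Matrix α α ℂ} {D' : Matrix β β ℂ}

lemma comm_star (h : IsDefectPair a D D') : D' * aᴴ = aᴴ * D := by
  have := congrArg conjTranspose h.comm
  simpa [h.left_self, h.right_self] using this

lemma isUnit_right (h : IsDefectPair a D D') : IsUnit D' := by
  have h1 : IsUnit (D' * D') := by
    rw [h.right_sq]
    exact isUnit_one_sub_mul h.norm_lt h.norm_lt.le
  rw [Matrix.isUnit_iff_isUnit_det, det_mul] at h1
  rw [Matrix.isUnit_iff_isUnit_det]
  exact isUnit_of_mul_isUnit_left h1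

/-- The unitary `[[a, D], [D', -a^*]]` maps `(h, -u x h)` to `(w h, x h)`, where
`x = (1 - a^* u)⁻¹ D'` and `w` is the value of the Möbius map at `u`. -/
lemma exists_colligation (h : IsDefectPair a D D') {u : Matrix α β ℂ} (hu : ‖u‖ ≤ 1) :
    ∃ x : Matrix β β ℂ, IsUnit x ∧ (1 - aᴴ * u)⁻¹ * D' = x ∧
      moebius a D D' u = a - D * (u * x) ∧ x = D' + aᴴ * (u * x) := by
  have hM := isUnit_one_sub_mul h.norm_lt hu
  have hMd := (Matrix.isUnit_iff_isUnit_det _).1 hM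
  refine ⟨_, ?_, rfl, ?_, ?_⟩
  · exact ((Matrix.isUnit_nonsing_inv_iff).2 hM).mul h.isUnit_right
  · simp [moebius, Matrix.mul_assoc]
  · have : (1 - aᴴ * u) * ((1 - aᴴ * u)⁻¹ * D') = D' := by
      rw [← Matrix.mul_assoc, Matrix.mul_nonsing_inv _ hMd, Matrix.one_mul]
    rw [Matrix.sub_mul, Matrix.one_mul, sub_eq_iff_eq_add, Matrix.mul_assoc] at this
    exact this

/-- The isometry of the colligation, for `w = a - D y` and `x = D' + a^* y` with `y = u x`. -/
lemma conjTranspose_mul_self_add (h : IsDefectPair a D D') {u : Matrix α β ℂ} {x : Matrix β β ℂ}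
    (hw : moebius a D D' u = a - D * (u * x)) (hx : x = D' + aᴴ * (u * x)) :
    (moebius a D D' u)ᴴ * moebius a D D' u + xᴴ * x = 1 + (u * x)ᴴ * (u * x) := by
  rw [hw]
  set y := u * x with hy
  have h1 : xᴴ * x = (D' + yᴴ * a) * (D' + aᴴ * y) := by
    conv_lhs => rw [hx]
    simp [h.right_self]
  have h2 : D * (D * y) = y - a * (aᴴ * y) := by
    rw [← Matrix.mul_assoc, h.left_sq, Matrix.sub_mul, Matrix.one_mul, Matrix.mul_assoc]
  have h3 : D' * (aᴴ * y) = aᴴ * (D * y) := by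
    rw [← Matrix.mul_assoc, h.comm_star, Matrix.mul_assoc]
  rw [h1]
  simp only [conjTranspose_sub, conjTranspose_mul, h.left_self, Matrix.sub_mul, Matrix.mul_sub,
    Matrix.add_mul, Matrix.mul_add, Matrix.mul_assoc, h2, h3, h.right_sq, h.comm]
  abel

lemma norm_moebius_sq (h : IsDefectPair a D D') {u : Matrix α β ℂ} {x : Matrix β β ℂ}
    (hw : moebius a D D' u = a - D * (u * x)) (hx : x = D' + aᴴ * (u * x))
    (k : EuclideanSpace ℂ β) :
    ‖act (moebius a D D' u) k‖ ^ 2 + ‖act x k‖ ^ 2 = ‖k‖ ^ 2 + ‖act u (act x k)‖ ^ 2 := by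
  have h1 := congrArg (fun A => (inner ℂ k (act A k)).re) (h.conjTranspose_mul_self_add hw hx)
  simp only [map_add, _root_.add_apply, inner_add_right, Complex.add_re, act_one] at h1
  rw [← norm_act_sq, ← norm_act_sq, ← norm_act_sq, inner_self_eq_norm_sq_to_K] at h1
  have h2 : (((‖k‖ : ℝ) : ℂ) ^ 2).re = ‖k‖ ^ 2 := by norm_cast
  rw [act_mul] at h1
  exact h1.trans (congrArg (· + _) h2)

lemma norm_moebius_le (h : IsDefectPair a D D') {u : Matrix α β ℂ} (hu : ‖u‖ ≤ 1) :
    ‖moebius a D D' u‖ ≤ 1 := by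
  obtain ⟨x, -, -, hw, hx⟩ := h.exists_colligation hu
  refine norm_le_of_norm_act_le zero_le_one fun k => ?_
  have h1 := h.norm_moebius_sq hw hx k
  have h2 := norm_act_le u (act x k)
  have h3 : ‖act u (act x k)‖ ≤ ‖act x k‖ :=
    h2.trans (mul_le_of_le_one_left (norm_nonneg _) hu)
  rw [one_mul]
  have h4 : ‖act u (act x k)‖ ^ 2 ≤ ‖act x k‖ ^ 2 := by gcongr
  exact (sq_le_sq₀ (norm_nonneg _) (norm_nonneg _)).1 (by linarith)

lemma norm_moebius_lt (h : IsDefectPair a D D') {u : Matrix α β ℂ} (hu : ‖u‖ < 1) :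
    ‖moebius a D D' u‖ < 1 := by
  rcases isEmpty_or_nonempty β with hβ | hβ
  · have : moebius a D D' u = 0 := by
      ext i j
      exact isEmptyElim j
    simp [this]
  obtain ⟨x, hxu, -, hw, hx⟩ := h.exists_colligation hu.le
  -- At a vector `k` where the value attains its norm, the colligation identity is strict.
  obtain ⟨k, hk, hmax⟩ := exists_norm_act_eq (moebius a D D' u)
  rw [← hmax]
  have h1 := h.norm_moebius_sq hw hx k
  have hxk : act x k ≠ 0 := by
    intro h0
    have : act (x⁻¹ * x) k = 0 := by rw [act_mul, h0, map_zero]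
    rw [Matrix.nonsing_inv_mul _ ((Matrix.isUnit_iff_isUnit_det _).1 hxu), act_one] at this
    simp [this] at hk
  have h3 : ‖act u (act x k)‖ < ‖act x k‖ :=
    (norm_act_le u (act x k)).trans_lt (mul_lt_of_lt_one_left (norm_pos_iff.2 hxk) hu)
  have h4 : ‖act u (act x k)‖ ^ 2 < ‖act x k‖ ^ 2 := by gcongr
  rw [hk] at h1
  exact (sq_lt_one_iff₀ (norm_nonneg _)).1 (by linarith)

/-- The Möbius map is an involution of the closed ball. -/
lemma moebius_moebius (h : IsDefectPair a D D') {u : Matrix α β ℂ} (hu : ‖u‖ ≤ 1) :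
    moebius a D D' (moebius a D D' u) = u := by
  obtain ⟨x, hxu, -, hw, hx⟩ := h.exists_colligation hu
  obtain ⟨x', -, hx', hw', -⟩ := h.exists_colligation (h.norm_moebius_le hu)
  have hxd := (Matrix.isUnit_iff_isUnit_det _).1 hxu
  have hDd := (Matrix.isUnit_iff_isUnit_det _).1 h.isUnit_right
  set w := moebius a D D' u with hwdef
  set y := u * x with hy
  have h1 : 1 - aᴴ * w = D' * x := by
    conv_rhs => rw [hx]
    rw [hw, Matrix.mul_add, h.right_sq, Matrix.mul_sub, ← Matrix.mul_assoc D', h.comm_star,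
      Matrix.mul_assoc]
    abel
  have h2 : x' = x⁻¹ := by
    rw [← hx', h1, Matrix.mul_inv_rev, Matrix.mul_assoc, Matrix.nonsing_inv_mul _ hDd,
      Matrix.mul_one]
  have h3 : D * w = (a - u) * x := by
    have hax : a * x = a * D' + a * aᴴ * y := by
      conv_lhs => rw [hx]
      rw [Matrix.mul_add, Matrix.mul_assoc]
    rw [hw, Matrix.sub_mul a u x, hax, ← hy, Matrix.mul_sub, ← Matrix.mul_assoc, h.left_sq,
      ← h.comm, Matrix.sub_mul, Matrix.one_mul]
    abel
  rw [hw', h2, ← Matrix.mul_assoc, h3, Matrix.mul_assoc, Matrix.mul_nonsing_inv _ hxd,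
    Matrix.mul_one, sub_sub_cancel]

lemma norm_moebius_eq_one_iff (h : IsDefectPair a D D') {u : Matrix α β ℂ} (hu : ‖u‖ ≤ 1) :
    ‖moebius a D D' u‖ = 1 ↔ ‖u‖ = 1 := by
  refine ⟨fun h1 => hu.antisymm (not_lt.1 fun h2 => (h.norm_moebius_lt h2).ne h1), fun h1 =>
    (h.norm_moebius_le hu).antisymm (not_lt.1 fun h2 => ?_)⟩
  have := h.norm_moebius_lt h2
  rw [h.moebius_moebius hu] at this
  exact this.ne h1

lemma moebius_self (h : IsDefectPair a D D') : moebius a D D' a = 0 := by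
  have h0 : moebius a D D' 0 = a := by simp [moebius]
  conv_lhs => rw [← h0]
  rw [h0]
  have := h.moebius_moebius (u := 0) (by simp)
  rwa [h0] at this

end IsDefectPair

/-- The intertwining `v (1 - v^* v)^{1/2} = (1 - v v^*)^{1/2} v` follows from the commutation of
the self-adjoint matrix `T = [[0, v], [v^*, 0]]` with the square root of `1 - T^2`. -/
lemma isDefectPair_sqrt {v : Matrix α β ℂ} (hv : ‖v‖ < 1) :
    IsDefectPair v (CFC.sqrt (1 - v * vᴴ)) (CFC.sqrt (1 - vᴴ * v)) := by
  have h1 := one_sub_conjTranspose_mul_self_nonneg hv.le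
  have h2 : (0 : Matrix α α ℂ) ≤ 1 - v * vᴴ := by
    have := one_sub_conjTranspose_mul_self_nonneg (v := vᴴ)
      (by rw [l2_opNorm_conjTranspose]; exact hv.le)
    rwa [conjTranspose_conjTranspose] at this
  have p1 := (CFC.sqrt_nonneg (1 - vᴴ * v)).posSemidef
  have p2 := (CFC.sqrt_nonneg (1 - v * vᴴ)).posSemidef
  have s1 := CFC.sqrt_mul_sqrt_self _ h1
  have s2 := CFC.sqrt_mul_sqrt_self _ h2
  refine ⟨hv, p2.isHermitian, p1.isHermitian, s2, s1, ?_⟩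
  set T : Matrix (α ⊕ β) (α ⊕ β) ℂ := fromBlocks 0 v vᴴ 0 with hT
  set S : Matrix (α ⊕ β) (α ⊕ β) ℂ := fromBlocks (CFC.sqrt (1 - v * vᴴ)) 0 0 (CFC.sqrt (1 - vᴴ * v))
    with hS
  have hSS : S * S = 1 + -(T * T) := by
    rw [hS, hT, fromBlocks_multiply, fromBlocks_multiply, ← fromBlocks_one, fromBlocks_neg,
      fromBlocks_add, s1, s2]
    simp [sub_eq_add_neg]
  have hS0 : 0 ≤ S := by
    have hq : (fromBlocks (CFC.sqrt (CFC.sqrt (1 - v * vᴴ))) 0 0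
        (CFC.sqrt (CFC.sqrt (1 - vᴴ * v))) : Matrix (α ⊕ β) (α ⊕ β) ℂ)ᴴ *
        fromBlocks (CFC.sqrt (CFC.sqrt (1 - v * vᴴ))) 0 0
          (CFC.sqrt (CFC.sqrt (1 - vᴴ * v))) = S := by
      rw [fromBlocks_conjTranspose, fromBlocks_multiply,
        (CFC.sqrt_nonneg (CFC.sqrt (1 - v * vᴴ))).posSemidef.isHermitian.eq,
        (CFC.sqrt_nonneg (CFC.sqrt (1 - vᴴ * v))).posSemidef.isHermitian.eq,
        CFC.sqrt_mul_sqrt_self _ (CFC.sqrt_nonneg _), CFC.sqrt_mul_sqrt_self _ (CFC.sqrt_nonneg _)]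
      simp [hS]
    rw [← hq]
    exact (Matrix.posSemidef_conjTranspose_mul_self _).nonneg
  have hS1 : CFC.sqrt (1 - T * T) = S := CFC.sqrt_unique (hSS.trans (sub_eq_add_neg _ _).symm) hS0
  have hcomm : Commute (1 - T * T) T := by
    change (1 - T * T) * T = T * (1 - T * T)
    noncomm_ring
  have hc : Commute (CFC.sqrt (1 - T * T)) T := hcomm.cfcₙ_nnreal _
  rw [hS1] at hc
  have h3 : S * T = T * S := hc
  rw [hS, hT, fromBlocks_multiply, fromBlocks_multiply, fromBlocks_inj] at h3
  simpa using h3.2.1.symm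

lemma DifferentiableOn.matrix_mul {γ E : Type*} [Fintype γ] [DecidableEq γ]
    [NormedAddCommGroup E] [NormedSpace ℂ E]
    {A : E → Matrix α β ℂ} {B : E → Matrix β γ ℂ} {s : Set E}
    (hA : DifferentiableOn ℂ A s) (hB : DifferentiableOn ℂ B s) :
    DifferentiableOn ℂ (fun z => A z * B z) s := by
  have hb : IsBoundedBilinearMap ℂ (fun p : Matrix α β ℂ × Matrix β γ ℂ => p.1 * p.2) :=
    { add_left := fun _ _ _ => Matrix.add_mul _ _ _
      smul_left := fun _ _ _ => Matrix.smul_mul _ _ _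
      add_right := fun _ _ _ => Matrix.mul_add _ _ _
      smul_right := fun _ _ _ => Matrix.mul_smul _ _ _
      bound := ⟨1, one_pos, fun A B => by rw [one_mul]; exact l2_opNorm_mul A B⟩ }
  exact hb.differentiable.comp_differentiableOn (hA.prodMk hB)

lemma ContinuousOn.matrix_mul {γ X : Type*} [Fintype γ] [DecidableEq γ] [TopologicalSpace X]
    {A : X → Matrix α β ℂ} {B : X → Matrix β γ ℂ} {s : Set X}
    (hA : ContinuousOn A s) (hB : ContinuousOn B s) : ContinuousOn (fun z => A z * B z) s :=
  (continuous_fst.matrix_mul continuous_snd).comp_continuousOn (hA.prodMk hB)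

lemma ContinuousOn.matrix_inv {X : Type*} [TopologicalSpace X] {A : X → Matrix β β ℂ} {s : Set X}
    (hA : ContinuousOn A s) (hu : ∀ z ∈ s, IsUnit (A z)) : ContinuousOn (fun z => (A z)⁻¹) s := by
  intro z hz
  simp only [Matrix.nonsing_inv_eq_ringInverse]
  obtain ⟨u, hu⟩ := hu z hz
  have := NormedRing.inverse_continuousAt u
  rw [hu] at this
  exact this.comp_continuousWithinAt (hA z hz)

lemma DifferentiableOn.matrix_inv {E : Type*} [NormedAddCommGroup E] [NormedSpace ℂ E]
    {A : E → Matrix β β ℂ} {s : Set E}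
    (hA : DifferentiableOn ℂ A s) (hu : ∀ z ∈ s, IsUnit (A z)) :
    DifferentiableOn ℂ (fun z => (A z)⁻¹) s := by
  intro z hz
  simp only [Matrix.nonsing_inv_eq_ringInverse]
  exact (differentiableAt_inverse (𝕜 := ℂ) (hu z hz)).comp_differentiableWithinAt z (hA z hz)

lemma IsDefectPair.continuousOn {X : Type*} [TopologicalSpace X] {a : Matrix α β ℂ}
    {D : Matrix α α ℂ} {D' : Matrix β β ℂ} (h : IsDefectPair a D D') {u : X → Matrix α β ℂ}
    {s : Set X} (hu : ContinuousOn u s) (h1 : ∀ z ∈ s, ‖u z‖ ≤ 1) :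
    ContinuousOn (fun z => moebius a D D' (u z)) s := by
  have hinv : ContinuousOn (fun z => (1 - aᴴ * u z)⁻¹) s :=
    (continuousOn_const.sub (continuousOn_const.matrix_mul hu)).matrix_inv
      fun z hz => isUnit_one_sub_mul h.norm_lt (h1 z hz)
  exact continuousOn_const.sub
    (((continuousOn_const.matrix_mul hu).matrix_mul hinv).matrix_mul continuousOn_const)

lemma IsDefectPair.differentiableOn {E : Type*} [NormedAddCommGroup E] [NormedSpace ℂ E]
    {a : Matrix α β ℂ} {D : Matrix α α ℂ} {D' : Matrix β β ℂ} (h : IsDefectPair a D D')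
    {u : E → Matrix α β ℂ} {s : Set E} (hu : DifferentiableOn ℂ u s) (h1 : ∀ z ∈ s, ‖u z‖ ≤ 1) :
    DifferentiableOn ℂ (fun z => moebius a D D' (u z)) s := by
  have hinv : DifferentiableOn ℂ (fun z => (1 - aᴴ * u z)⁻¹) s :=
    ((differentiableOn_const _).sub ((differentiableOn_const _).matrix_mul hu)).matrix_inv
      fun z hz => isUnit_one_sub_mul h.norm_lt (h1 z hz)
  exact (differentiableOn_const _).sub
    ((((differentiableOn_const _).matrix_mul hu).matrix_mul hinv).matrix_mul
      (differentiableOn_const _))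

end Moebius

/-! ### Scalar matrices at level `n` -/

namespace NCMat

open Matrix

variable {p q r s t n : ℕ}

lemma const_mul_const (A : Matrix (Fin r) (Fin s) ℂ) (B : Matrix (Fin s) (Fin t) ℂ) (n : ℕ) :
    const A n * const B n = const (A * B) n := by
  simp [const, ← Matrix.mul_kronecker_mul]

lemma const_conjTranspose (A : Matrix (Fin r) (Fin s) ℂ) (n : ℕ) :
    (const A n)ᴴ = const Aᴴ n := by
  simp [const, conjTranspose_kronecker]

lemma const_one (n : ℕ) : const (1 : Matrix (Fin r) (Fin r) ℂ) n = 1 := by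
  simp [const]

lemma const_add (A B : Matrix (Fin r) (Fin s) ℂ) (n : ℕ) :
    const (A + B) n = const A n + const B n := by
  simp [const, add_kronecker]

lemma const_sub (A B : Matrix (Fin r) (Fin s) ℂ) (n : ℕ) :
    const (A - B) n = const A n - const B n := by
  rw [eq_sub_iff_add_eq, ← const_add, sub_add_cancel]

lemma const_zero (n : ℕ) : const (0 : Matrix (Fin r) (Fin s) ℂ) n = 0 := by
  simp [const]

lemma const_apply (A : Matrix (Fin r) (Fin s) ℂ) (n : ℕ) (i : Fin r × Fin n) (j : Fin s × Fin n) :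
    const A n i j = A i.1 j.1 * (1 : Matrix (Fin n) (Fin n) ℂ) i.2 j.2 := rfl

lemma act_const_apply (A : Matrix (Fin r) (Fin s) ℂ) (n : ℕ)
    (x : EuclideanSpace ℂ (Fin s × Fin n)) (i : Fin r) (a : Fin n) :
    act (const A n) x (i, a) = act A (WithLp.toLp 2 fun j => x (j, a)) i := by
  rw [act_apply, act_apply, Fintype.sum_prod_type]
  refine Finset.sum_congr rfl fun j _ => ?_
  simp [const_apply, Matrix.one_apply]

lemma norm_const_le (A : Matrix (Fin r) (Fin s) ℂ) (n : ℕ) : ‖const A n‖ ≤ ‖A‖ := by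
  refine norm_le_of_norm_act_le (norm_nonneg _) fun x => ?_
  rw [← sq_le_sq₀ (norm_nonneg _) (by positivity), EuclideanSpace.norm_sq_eq,
    Fintype.sum_prod_type_right, mul_pow, EuclideanSpace.norm_sq_eq x, Fintype.sum_prod_type_right,
    Finset.mul_sum]
  refine Finset.sum_le_sum fun a _ => ?_
  have h := norm_act_le A (WithLp.toLp 2 fun j => x (j, a))
  rw [← sq_le_sq₀ (norm_nonneg _) (by positivity), mul_pow, EuclideanSpace.norm_sq_eq,
    EuclideanSpace.norm_sq_eq] at h
  simpa only [act_const_apply] using h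

end NCMat

section ScalarMatrices

open NCMat Matrix

lemma IsDefectPair.const {r s : ℕ} {v : Matrix (Fin r) (Fin s) ℂ} {D : Matrix (Fin r) (Fin r) ℂ}
    {D' : Matrix (Fin s) (Fin s) ℂ} (h : IsDefectPair v D D') (n : ℕ) :
    IsDefectPair (NCMat.const v n) (NCMat.const D n) (NCMat.const D' n) where
  norm_lt := (norm_const_le v n).trans_lt h.norm_lt
  left_self := by rw [const_conjTranspose, h.left_self]
  right_self := by rw [const_conjTranspose, h.right_self]
  left_sq := by
    rw [const_conjTranspose, const_mul_const, const_mul_const, h.left_sq, const_sub, const_one]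
  right_sq := by
    rw [const_conjTranspose, const_mul_const, const_mul_const, h.right_sq, const_sub, const_one]
  comm := by rw [const_mul_const, const_mul_const, h.comm]

lemma isDefectPair_linFrac {r s : ℕ} {v : Matrix (Fin r) (Fin s) ℂ} (hv : ‖v‖ < 1) (n : ℕ) :
    IsDefectPair (NCMat.const v n) (NCMat.const (CFC.sqrt (1 - v * vᴴ)) n)
      (NCMat.const (CFC.sqrt (1 - vᴴ * v)) n) :=
  (isDefectPair_sqrt hv).const n

lemma linFrac_eq_moebius {r s : ℕ} (v : Matrix (Fin r) (Fin s) ℂ) {n : ℕ} (u : NCMat r s n) :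
    linFrac v u = moebius (NCMat.const v n) (NCMat.const (CFC.sqrt (1 - v * vᴴ)) n)
      (NCMat.const (CFC.sqrt (1 - vᴴ * v)) n) u := by
  rw [linFrac, moebius, const_conjTranspose]

/-! ### Homogeneous NC polynomials -/

section HomPart

variable {p q r s t n : ℕ}

lemma ncHomPart_zero (a : List (Fin p × Fin q) → Matrix (Fin r) (Fin s) ℂ) (X : NCMat p q n) :
    ncHomPart a 0 X = NCMat.const (a []) n := by
  simp [ncHomPart, NCMat.word, NCMat.const]

lemma ncHomPart_one (a : List (Fin p × Fin q) → Matrix (Fin r) (Fin s) ℂ) (X : NCMat p q n) :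
    ncHomPart a 1 X = ∑ k, a [k] ⊗ₖ X.entry k := by
  rw [ncHomPart, ← (Equiv.funUnique (Fin 1) (Fin p × Fin q)).symm.sum_comp]
  simp [NCMat.word]

lemma ncHomPart_congr {a b : List (Fin p × Fin q) → Matrix (Fin r) (Fin s) ℂ} {m : ℕ}
    (h : ∀ w, w.length = m → a w = b w) (X : NCMat p q n) :
    ncHomPart a m X = ncHomPart b m X := by
  refine Finset.sum_congr rfl fun w _ => ?_
  rw [h _ (List.length_ofFn)]

lemma ncHomPart_add (a b : List (Fin p × Fin q) → Matrix (Fin r) (Fin s) ℂ) (m : ℕ)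
    (X : NCMat p q n) :
    ncHomPart (fun w => a w + b w) m X = ncHomPart a m X + ncHomPart b m X := by
  simp [ncHomPart, add_kronecker, Finset.sum_add_distrib]

lemma const_mul_ncHomPart (B : Matrix (Fin t) (Fin r) ℂ)
    (a : List (Fin p × Fin q) → Matrix (Fin r) (Fin s) ℂ) (m : ℕ) (X : NCMat p q n) :
    NCMat.const B n * ncHomPart a m X = ncHomPart (fun w => B * a w) m X := by
  simp [ncHomPart, NCMat.const, Matrix.mul_sum, ← Matrix.mul_kronecker_mul]

lemma ncHomPart_mul_const (a : List (Fin p × Fin q) → Matrix (Fin r) (Fin s) ℂ) (m : ℕ)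
    (X : NCMat p q n) (B : Matrix (Fin s) (Fin t) ℂ) :
    ncHomPart a m X * NCMat.const B n = ncHomPart (fun w => a w * B) m X := by
  simp [ncHomPart, NCMat.const, Matrix.sum_mul, ← Matrix.mul_kronecker_mul]

lemma ncHomPart_mul (a : List (Fin p × Fin q) → Matrix (Fin r) (Fin s) ℂ)
    (b : List (Fin p × Fin q) → Matrix (Fin s) (Fin t) ℂ) (k l : ℕ) (X : NCMat p q n) :
    ncHomPart a k X * ncHomPart b l X =
      ncHomPart (fun w => a (w.take k) * b (w.drop k)) (k + l) X := by
  rw [ncHomPart, ncHomPart, ncHomPart, ← (Fin.appendEquiv k l).sum_comp, Fintype.sum_prod_type,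
    Matrix.sum_mul]
  refine Finset.sum_congr rfl fun u _ => ?_
  rw [Matrix.mul_sum]
  refine Finset.sum_congr rfl fun v _ => ?_
  have h1 : List.ofFn ((Fin.appendEquiv k l) (u, v)) = List.ofFn u ++ List.ofFn v :=
    List.ofFn_fin_append u v
  rw [h1, List.take_left' List.length_ofFn, List.drop_left' List.length_ofFn,
    ← Matrix.mul_kronecker_mul]
  simp [NCMat.word]

lemma NCMat.word_smul (z : ℂ) (X : NCMat p q n) (w : List (Fin p × Fin q)) :
    (z • X).word w = z ^ w.length • X.word w := by
  induction w with
  | nil => simp [NCMat.word]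
  | cons k w ih =>
    have h : (z • X).entry k = z • X.entry k := rfl
    simp only [NCMat.word, List.map_cons, List.prod_cons, List.length_cons] at ih ⊢
    rw [ih, h, smul_mul_smul_comm, pow_succ']

lemma ncHomPart_smul (a : List (Fin p × Fin q) → Matrix (Fin r) (Fin s) ℂ) (m : ℕ) (z : ℂ)
    (X : NCMat p q n) : ncHomPart a m (z • X) = z ^ m • ncHomPart a m X := by
  rw [ncHomPart, ncHomPart, Finset.smul_sum]
  refine Finset.sum_congr rfl fun w _ => ?_
  rw [NCMat.word_smul, List.length_ofFn, kronecker_smul]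

/-- The coefficients of the NC polynomial `∑ x_{ij} E_{ij}`, that is of the identity map. -/
noncomputable def idCoeff (w : List (Fin p × Fin q)) : Matrix (Fin p) (Fin q) ℂ :=
  match w with
  | [k] => Matrix.single k.1 k.2 1
  | _ => 0

lemma ncHomPart_idCoeff (m : ℕ) (X : NCMat p q n) :
    ncHomPart idCoeff m X = if m = 1 then X else 0 := by
  match m with
  | 0 => simp [ncHomPart_zero, idCoeff, NCMat.const_zero]
  | 1 =>
    rw [ncHomPart_one, if_pos rfl]
    ext ⟨i, a⟩ ⟨j, b⟩
    simp only [idCoeff, Matrix.sum_apply, kroneckerMap_apply]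
    rw [Finset.sum_eq_single (i, j)]
    · simp [NCMat.entry]
    · rintro ⟨i', j'⟩ - h
      rw [Matrix.single_apply_of_ne, zero_mul]
      rintro ⟨rfl, rfl⟩
      exact h rfl
    · simp
  | m + 2 =>
    rw [if_neg (by omega)]
    refine Finset.sum_eq_zero fun w _ => ?_
    simp [List.ofFn_succ, idCoeff]

/-- The coefficients of `X ↦ f(X^*)^*` when `f` has the coefficients `a`. -/
def adjCoeff (a : List (Fin p × Fin q) → Matrix (Fin r) (Fin s) ℂ) (w : List (Fin q × Fin p)) :
    Matrix (Fin s) (Fin r) ℂ :=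
  (a (w.map Prod.swap).reverse)ᴴ

lemma NCMat.word_conjTranspose (X : NCMat p q n) (w : List (Fin p × Fin q)) :
    (X.word w)ᴴ = NCMat.word Xᴴ (w.map Prod.swap).reverse := by
  rw [NCMat.word, NCMat.word, conjTranspose_list_prod]
  simp only [List.map_map, List.map_reverse]
  rfl

lemma ncHomPart_conjTranspose (a : List (Fin p × Fin q) → Matrix (Fin r) (Fin s) ℂ) (m : ℕ)
    (X : NCMat p q n) : (ncHomPart a m X)ᴴ = ncHomPart (adjCoeff a) m Xᴴ := by
  rw [ncHomPart, ncHomPart, conjTranspose_sum,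
    ← (Equiv.arrowCongr (Fin.revPerm (n := m)) (Equiv.prodComm (Fin p) (Fin q))).sum_comp]
  refine Finset.sum_congr rfl fun w _ => ?_
  have h : List.ofFn ((Equiv.arrowCongr (Fin.revPerm (n := m))
      (Equiv.prodComm (Fin p) (Fin q))) w) = ((List.ofFn w).map Prod.swap).reverse := by
    apply List.ext_getElem <;> simp [Fin.rev, Nat.sub_sub, Nat.add_comm]
  rw [h, conjTranspose_kronecker, NCMat.word_conjTranspose]
  have h' : (((List.ofFn w).map Prod.swap).reverse.map Prod.swap).reverse = List.ofFn w := by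
    simp [List.map_reverse, Function.comp_def]
  rw [adjCoeff, h']

lemma ncHomPart_eq_zero_of_nilpotent (a : List (Fin p × Fin q) → Matrix (Fin r) (Fin s) ℂ)
    {m : ℕ} (hm : 2 ≤ m) {X : NCMat p q n} (hX : ∀ k l, X.entry k * X.entry l = 0) :
    ncHomPart a m X = 0 := by
  obtain ⟨m, rfl⟩ := Nat.exists_eq_add_of_le' hm
  refine Finset.sum_eq_zero fun w _ => ?_
  have h : X.word (List.ofFn w) = 0 := by
    simp [NCMat.word, List.ofFn_succ, ← Matrix.mul_assoc, hX]
  rw [h, kronecker_zero]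

/-- If `Y` has the block form `[[X, 0], [*, *]]` (in every entry, with respect to the coordinates
in the range of `e`), then the words in `Y` are `[[w(X), 0], [*, *]]`. -/
lemma NCMat.word_compress {N : ℕ} {X : NCMat p q n} {Y : NCMat p q N} {e : Fin n → Fin N}
    (he : Function.Injective e) (h1 : ∀ i a j b, Y (i, e a) (j, e b) = X (i, a) (j, b))
    (h2 : ∀ i a j c, c ∉ Set.range e → Y (i, e a) (j, c) = 0) (w : List (Fin p × Fin q)) :
    (∀ a b, Y.word w (e a) (e b) = X.word w a b) ∧
      ∀ a c, c ∉ Set.range e → Y.word w (e a) c = 0 := by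
  induction w with
  | nil =>
    refine ⟨fun a b => ?_, fun a c hc => ?_⟩
    · simp [NCMat.word, Matrix.one_apply, he.eq_iff]
    · have : e a ≠ c := fun h => hc ⟨a, h⟩
      simp [NCMat.word, this]
  | cons k w ih =>
    have key : ∀ a c, Y.word (k :: w) (e a) c = ∑ b, X.entry k a b * Y.word w (e b) c := by
      intro a c
      have h3 : Y.word (k :: w) (e a) c = ∑ d, Y.entry k (e a) d * Y.word w d c := by
        simp [NCMat.word, Matrix.mul_apply]
      rw [h3, ← Finset.sum_subset (Finset.subset_univ (Finset.univ.map ⟨e, he⟩)), Finset.sum_map]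
      · exact Finset.sum_congr rfl fun b _ => congrArg (· * _) (h1 _ _ _ _)
      · intro d _ hd
        have : Y.entry k (e a) d = 0 := h2 _ _ _ _ (by simpa using hd)
        rw [this, zero_mul]
    refine ⟨fun a b => ?_, fun a c hc => ?_⟩
    · simp only [key, ih.1]
      simp [NCMat.word, Matrix.mul_apply]
    · simp [key, ih.2 _ _ hc]

lemma ncHomPart_compress {N : ℕ} {X : NCMat p q n} {Y : NCMat p q N} {e : Fin n → Fin N}
    (he : Function.Injective e) (h1 : ∀ i a j b, Y (i, e a) (j, e b) = X (i, a) (j, b))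
    (h2 : ∀ i a j c, c ∉ Set.range e → Y (i, e a) (j, c) = 0)
    (a : List (Fin p × Fin q) → Matrix (Fin r) (Fin s) ℂ) (m : ℕ) (i : Fin r) (k : Fin n)
    (j : Fin s) (l : Fin n) :
    ncHomPart a m Y (i, e k) (j, e l) = ncHomPart a m X (i, k) (j, l) := by
  simp only [ncHomPart, Matrix.sum_apply, kroneckerMap_apply]
  exact Finset.sum_congr rfl fun w _ => by rw [(NCMat.word_compress he h1 h2 _).1]

end HomPart

end ScalarMatrices

/-! ### Power series in one variable with matrix coefficients -/

section OneVariable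

variable {E : Type*} [NormedAddCommGroup E] [NormedSpace ℂ E]

lemma powerSeries_coeff_unique {c c' : ℕ → E}
    (h : ∀ᶠ z in 𝓝 (0 : ℂ), ∃ y, HasSum (fun m => z ^ m • c m) y ∧
      HasSum (fun m => z ^ m • c' m) y) (m : ℕ) : c m = c' m := by
  let P : FormalMultilinearSeries ℂ ℂ E := fun k =>
    ContinuousMultilinearMap.mkPiRing ℂ (Fin k) (c k - c' k)
  have hP : ∀ k, P.coeff k = c k - c' k := fun k => by simp [P, FormalMultilinearSeries.coeff]
  have h0 : HasFPowerSeriesAt (0 : ℂ → E) P 0 := by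
    rw [hasFPowerSeriesAt_iff]
    filter_upwards [h] with z hz
    obtain ⟨y, h1, h2⟩ := hz
    simpa [hP, smul_sub] using h1.sub h2
  have h1 := hP m
  rw [h0.eq_zero] at h1
  exact sub_eq_zero.1 (h1.symm.trans (by simp [FormalMultilinearSeries.coeff]))

lemma exists_taylor [CompleteSpace E] {F : ℂ → E} {R : ℝ}
    (hF : DifferentiableOn ℂ F (Metric.ball 0 R)) :
    ∃ c : ℕ → E, ∀ z ∈ Metric.ball (0 : ℂ) R, HasSum (fun m => z ^ m • c m) (F z) := by
  refine ⟨fun m => (m.factorial : ℂ)⁻¹ • iteratedDeriv m F 0, fun z hz => ?_⟩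
  have h := Complex.hasSum_taylorSeries_on_ball hF hz
  simp only [sub_zero] at h
  convert! h using 2 with m
  exact smul_comm _ _ _

/-- NC power series are assumed to converge only as limits of partial sums; inside the disc of
convergence this is absolute convergence. -/
lemma summable_of_tendsto_partialSums [CompleteSpace E] {c : ℕ → E} {w z : ℂ} {y : E}
    (h : Tendsto (fun M => ∑ m ∈ Finset.range M, w ^ m • c m) atTop (𝓝 y)) (hz : ‖z‖ < ‖w‖) :
    Summable fun m => z ^ m • c m := by
  have hw : 0 < ‖w‖ := (norm_nonneg z).trans_lt hz
  have h0 : Tendsto (fun m => w ^ m • c m) atTop (𝓝 0) := by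
    have := (h.comp (tendsto_add_atTop_nat 1)).sub h
    simpa [Function.comp_def, Finset.sum_range_succ] using this
  obtain ⟨C, hC⟩ := h0.norm.bddAbove_range
  have hC' : ∀ m, ‖w‖ ^ m * ‖c m‖ ≤ C := fun m => by
    have := hC (Set.mem_range_self m)
    simpa [norm_smul] using this
  refine Summable.of_norm_bounded
    ((summable_geometric_of_lt_one (div_nonneg (norm_nonneg z) hw.le)
      ((div_lt_one hw).2 hz)).mul_left C) fun m => ?_
  rw [norm_smul, norm_pow, div_pow, mul_div_assoc', le_div_iff₀ (pow_pos hw m)]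
  calc ‖z‖ ^ m * ‖c m‖ * ‖w‖ ^ m = (‖w‖ ^ m * ‖c m‖) * ‖z‖ ^ m := by ring
    _ ≤ C * ‖z‖ ^ m := by gcongr; exact hC' m

end OneVariable

section MatrixSeries

variable {α β γ : Type*} [Fintype α] [DecidableEq α] [Fintype β] [DecidableEq β]
  [Fintype γ] [DecidableEq γ]

lemma HasSum.const_matrix_mul {A : ℕ → Matrix β γ ℂ} {a : Matrix β γ ℂ} (h : HasSum A a)
    (B : Matrix α β ℂ) : HasSum (fun m => B * A m) (B * a) :=
  h.map (AddMonoidHom.mk' (fun x : Matrix β γ ℂ => B * x) (Matrix.mul_add B))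
    (continuous_const.matrix_mul continuous_id)

lemma HasSum.matrix_mul_const {A : ℕ → Matrix α β ℂ} {a : Matrix α β ℂ} (h : HasSum A a)
    (B : Matrix β γ ℂ) : HasSum (fun m => A m * B) (a * B) :=
  h.map (AddMonoidHom.mk' (fun x : Matrix α β ℂ => x * B) fun x y => Matrix.add_mul x y B)
    (continuous_id.matrix_mul continuous_const)

lemma HasSum.matrix_apply {A : ℕ → Matrix α β ℂ} {a : Matrix α β ℂ} (h : HasSum A a) (i : α)
    (j : β) : HasSum (fun m => A m i j) (a i j) :=
  Pi.hasSum.1 (Pi.hasSum.1 h i) j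

lemma HasSum.matrix_cauchyProduct {A : ℕ → Matrix α β ℂ} {B : ℕ → Matrix β γ ℂ}
    {a : Matrix α β ℂ} {b : Matrix β γ ℂ} (hA : HasSum A a) (hB : HasSum B b) :
    HasSum (fun m => ∑ k ∈ Finset.HasAntidiagonal.antidiagonal m, A k.1 * B k.2) (a * b) := by
  refine Pi.hasSum.2 fun i => Pi.hasSum.2 fun j => ?_
  have h : ∀ l : β, HasSum
      (fun m => ∑ k ∈ Finset.HasAntidiagonal.antidiagonal m, A k.1 i l * B k.2 l j)
      (a i l * b l j) := by
    intro l
    have h1 := hA.matrix_apply i l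
    have h2 := hB.matrix_apply l j
    have n1 := summable_norm_iff.2 h1.summable
    have n2 := summable_norm_iff.2 h2.summable
    rw [← h1.tsum_eq, ← h2.tsum_eq, tsum_mul_tsum_eq_tsum_sum_antidiagonal_of_summable_norm n1 n2]
    exact (summable_norm_sum_mul_antidiagonal_of_summable_norm n1 n2).of_norm.hasSum
  convert! hasSum_sum (s := Finset.univ) fun l _ => h l using 1
  ext m
  simp only [Matrix.sum_apply, Matrix.mul_apply]
  exact Finset.sum_comm

end MatrixSeries

/-! ### NC power series on the whole ball -/

section Series

variable {p q r s t n : ℕ}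

open Matrix

/-- `f` is contraction valued on the ball and there the sum of the NC power series with
coefficients `a`. -/
structure IsSchurSeries (a : List (Fin p × Fin q) → Matrix (Fin r) (Fin s) ℂ)
    (f : NCMap p q r s) : Prop where
  hasSum : ∀ (n : ℕ) (X : NCMat p q n), ‖X‖ < 1 → HasSum (fun m => ncHomPart a m X) (f n X)
  contraction : IsContractionValued f

lemma smul_mem_ball {X : NCMat p q n} (hX : ‖X‖ ≤ 1) {z : ℂ} (hz : z ∈ Metric.ball (0 : ℂ) 1) :
    ‖z • X‖ < 1 := by
  rw [norm_smul]
  have : ‖z‖ < 1 := by simpa using hz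
  nlinarith [norm_nonneg X, norm_nonneg z]

lemma exists_radius {X : NCMat p q n} (hX : ‖X‖ < 1) :
    ∃ R : ℝ, 1 < R ∧ ∀ z ∈ Metric.ball (0 : ℂ) R, ‖z • X‖ < 1 := by
  refine ⟨2 / (1 + ‖X‖), ?_, fun z hz => ?_⟩
  · rw [lt_div_iff₀ (by positivity)]
    linarith
  · have hz' : ‖z‖ < 2 / (1 + ‖X‖) := by simpa using hz
    rw [lt_div_iff₀ (by positivity)] at hz'
    rw [norm_smul]
    nlinarith [norm_nonneg X, norm_nonneg z]

/-- The substitution property, for the disc regarded as a domain in `ℂ^1`. -/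
lemma IsNCAnalyticOnBall.differentiableOn_slice {f : NCMap p q r s} (hf : IsNCAnalyticOnBall f)
    {X : NCMat p q n} {R : ℝ} (hR : 0 < R) (hX : ∀ z ∈ Metric.ball (0 : ℂ) R, ‖z • X‖ < 1) :
    DifferentiableOn ℂ (fun z : ℂ => f n (z • X)) (Metric.ball 0 R) := by
  set W : Set (Fin 1 → ℂ) := Metric.ball 0 R
  have hW : ∀ z ∈ W, z 0 ∈ Metric.ball (0 : ℂ) R := fun z hz =>
    mem_ball_zero_iff.2 ((norm_le_pi_norm z 0).trans_lt (mem_ball_zero_iff.1 hz))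
  have h := (hf.comp_analytic 1 n W (fun z => z 0 • X) Metric.isOpen_ball
    (Metric.isConnected_ball hR) ?_ fun z hz => hX _ (hW z hz)).1
  · refine h.comp (t := W) (f := fun z : ℂ => fun _ : Fin 1 => z) (s := Metric.ball (0 : ℂ) R) ?_ ?_
    · exact (differentiable_pi.2 fun _ => differentiable_id).differentiableOn
    · intro z hz
      rw [mem_ball_zero_iff] at hz ⊢
      simpa [pi_norm_lt_iff hR] using hz
  · exact ((differentiable_apply (0 : Fin 1)).smul_const X).differentiableOn

/-- An NC power series of an NC analytic contraction valued map converges on the whole ball: along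
each complex line through `0` it is the Taylor series of a function on a disc. -/
lemma exists_isSchurSeries {f : NCMap p q r s} (hf : IsNCAnalyticOnBall f)
    (hc : IsContractionValued f) : ∃ a, IsSchurSeries a f := by
  obtain ⟨a, ε, hε, ha⟩ := hf.powerSeries
  refine ⟨a, fun n X hX => ?_, hc⟩
  obtain ⟨R, hR, hXR⟩ := exists_radius hX
  obtain ⟨c, hcs⟩ := exists_taylor
    (hf.differentiableOn_slice (zero_lt_one.trans hR) hXR)
  -- Near `0` both series represent the same function of `z`.
  have hcoeff : ∀ m, c m = ncHomPart a m X := by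
    refine powerSeries_coeff_unique ?_
    have hδ : 0 < min 1 ε / 2 := by positivity
    have hlim : ∀ z : ℂ, ‖z‖ ≤ min 1 ε / 2 → Tendsto (fun M : ℕ => ∑ m ∈ Finset.range M,
        z ^ m • ncHomPart a m X) atTop (𝓝 (f n (z • X))) := by
      intro z hz
      have h1 : ‖z • X‖ < min 1 ε := by
        rw [norm_smul]
        nlinarith [norm_nonneg X, norm_nonneg z]
      have := ha n (z • X) (h1.trans_le (min_le_left _ _)) (h1.trans_le (min_le_right _ _))
      simpa only [ncHomPart_smul] using this
    filter_upwards [Metric.ball_mem_nhds (0 : ℂ) hδ] with z hz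
    have hz' : ‖z‖ < min 1 ε / 2 := by simpa using hz
    have hz1 : z ∈ Metric.ball (0 : ℂ) R := by
      have := min_le_left 1 ε
      rw [mem_ball_zero_iff]
      linarith
    have hw : ‖((min 1 ε / 2 : ℝ) : ℂ)‖ = min 1 ε / 2 := by
      rw [Complex.norm_real, Real.norm_of_nonneg hδ.le]
    have hs := summable_of_tendsto_partialSums (z := z) (hlim _ hw.le) (by rwa [hw])
    refine ⟨_, hcs z hz1, ?_⟩
    convert! hs.hasSum using 1
    exact tendsto_nhds_unique (hlim z hz'.le) hs.hasSum.tendsto_sum_nat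
  have h1 := hcs 1 (by simpa using hR)
  simpa [hcoeff] using h1

lemma IsNCAnalyticOnBall.of_hasSum {f : NCMap p q r s}
    {a : List (Fin p × Fin q) → Matrix (Fin r) (Fin s) ℂ}
    (h : ∀ (n : ℕ) (X : NCMat p q n), ‖X‖ < 1 → HasSum (fun m => ncHomPart a m X) (f n X))
    (hc : ∀ (N n : ℕ) (W : Set (Fin N → ℂ)) (α : (Fin N → ℂ) → NCMat p q n),
    IsOpen W → IsConnected W → DifferentiableOn ℂ α W → Set.MapsTo α W (ncOpenBall p q n) →
      DifferentiableOn ℂ (fun z => f n (α z)) W ∧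
      (ContinuousOn α (closure W) → Set.MapsTo α (closure W) (ncOpenBall p q n) →
        ContinuousOn (fun z => f n (α z)) (closure W))) : IsNCAnalyticOnBall f :=
  ⟨⟨a, 1, one_pos, fun n X hX _ => (h n X hX).tendsto_sum_nat⟩, hc⟩

lemma IsNCAnalyticOnBall.congr {f f' : NCMap p q r s} (hf : IsNCAnalyticOnBall f)
    (h : ∀ (n : ℕ) (X : NCMat p q n), ‖X‖ < 1 → f' n X = f n X) : IsNCAnalyticOnBall f' := by
  obtain ⟨⟨a, ε, hε, ha⟩, hc⟩ := hf
  refine ⟨⟨a, ε, hε, fun n X hX hXε => ?_⟩, fun N n W α hW hW' hα hm => ?_⟩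
  · rw [h n X hX]
    exact ha n X hX hXε
  · obtain ⟨h1, h2⟩ := hc N n W α hW hW' hα hm
    exact ⟨h1.congr fun z hz => h n _ (hm hz),
      fun hα' hm' => (h2 hα' hm').congr fun z hz => h n _ (hm' hz)⟩

lemma IsNCAnalyticOnBall.const_mul_mul_const {r' s' : ℕ} {f : NCMap p q r s}
    (hf : IsNCAnalyticOnBall f) (B : Matrix (Fin r') (Fin r) ℂ) (C : Matrix (Fin s) (Fin s') ℂ) :
    IsNCAnalyticOnBall fun n X => NCMat.const B n * f n X * NCMat.const C n := by
  obtain ⟨⟨a, ε, hε, ha⟩, hc⟩ := hf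
  refine ⟨⟨fun w => B * a w * C, ε, hε, fun n X hX hXε => ?_⟩, fun N n W α hW hW' hα hm => ?_⟩
  · simp only [← ncHomPart_mul_const, ← const_mul_ncHomPart, ← Matrix.sum_mul, ← Matrix.mul_sum]
    exact ((continuous_const.matrix_mul continuous_id).matrix_mul continuous_const).tendsto
      (f n X) |>.comp (ha n X hX hXε)
  · obtain ⟨h1, h2⟩ := hc N n W α hW hW' hα hm
    exact ⟨((differentiableOn_const _).matrix_mul h1).matrix_mul (differentiableOn_const _),
      fun hα' hm' => (continuousOn_const.matrix_mul (h2 hα' hm')).matrix_mul continuousOn_const⟩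

lemma IsNCAnalyticOnBall.add {f f' : NCMap p q r s} (hf : IsNCAnalyticOnBall f)
    (hf' : IsNCAnalyticOnBall f') : IsNCAnalyticOnBall fun n X => f n X + f' n X := by
  obtain ⟨⟨a, ε, hε, ha⟩, hc⟩ := hf
  obtain ⟨⟨a', ε', hε', ha'⟩, hc'⟩ := hf'
  refine ⟨⟨fun w => a w + a' w, min ε ε', lt_min hε hε', fun n X hX hXε => ?_⟩,
    fun N n W α hW hW' hα hm => ?_⟩
  · simp only [ncHomPart_add, Finset.sum_add_distrib]
    exact (ha n X hX (hXε.trans_le (min_le_left _ _))).add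
      (ha' n X hX (hXε.trans_le (min_le_right _ _)))
  · obtain ⟨h1, h2⟩ := hc N n W α hW hW' hα hm
    obtain ⟨h1', h2'⟩ := hc' N n W α hW hW' hα hm
    exact ⟨h1.add h1', fun hα' hm' => (h2 hα' hm').add (h2' hα' hm')⟩

lemma isNCAnalyticOnBall_id : IsNCAnalyticOnBall fun n (X : NCMat p q n) => X := by
  refine .of_hasSum (a := idCoeff) (fun n X hX => ?_) fun N n W α _ _ hα _ => ⟨hα, fun h _ => h⟩
  simp only [ncHomPart_idCoeff]
  exact hasSum_ite_eq 1 X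

lemma norm_le_norm_const_one (A : Matrix (Fin r) (Fin s) ℂ) : ‖A‖ ≤ ‖NCMat.const A 1‖ := by
  refine norm_le_of_norm_act_le (norm_nonneg _) fun x => ?_
  have h := norm_act_le (NCMat.const A 1)
    (WithLp.toLp 2 fun j : Fin s × Fin 1 => x j.1 : EuclideanSpace ℂ (Fin s × Fin 1))
  rw [← sq_le_sq₀ (norm_nonneg _) (by positivity), mul_pow, EuclideanSpace.norm_sq_eq,
    EuclideanSpace.norm_sq_eq (WithLp.toLp 2 fun j : Fin s × Fin 1 => x j.1), Fintype.sum_prod_type,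
    Fintype.sum_prod_type] at h
  rw [← sq_le_sq₀ (norm_nonneg _) (by positivity), mul_pow, EuclideanSpace.norm_sq_eq,
    EuclideanSpace.norm_sq_eq x]
  have h1 : ∀ i : Fin r, act (NCMat.const A 1)
      (WithLp.toLp 2 fun j : Fin s × Fin 1 => x j.1) (i, 0) = act A x i := fun i =>
    NCMat.act_const_apply _ _ _ _ _
  simpa only [h1, Finset.univ_unique, Fin.default_eq_zero, Finset.sum_singleton] using h

lemma IsSchurSeries.map_zero {f : NCMap p q r s}
    {a : List (Fin p × Fin q) → Matrix (Fin r) (Fin s) ℂ} (h : IsSchurSeries a f) (n : ℕ) :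
    f n 0 = NCMat.const (a []) n := by
  have h1 := h.hasSum n 0 (by simp)
  have h2 : HasSum (fun m => ncHomPart a m (0 : NCMat p q n)) (ncHomPart a 0 0) := by
    refine hasSum_single 0 fun m hm => ?_
    have := ncHomPart_smul a m 0 (0 : NCMat p q n)
    simpa [hm] using this
  rw [h1.unique h2, ncHomPart_zero]

lemma IsSchurSeries.ncValueZero_eq {f : NCMap p q r s}
    {a : List (Fin p × Fin q) → Matrix (Fin r) (Fin s) ℂ} (h : IsSchurSeries a f) :
    ncValueZero f = a [] := by
  ext i j
  simp [ncValueZero, h.map_zero, NCMat.const_apply]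

lemma IsSchurSeries.norm_coeff_nil_le {f : NCMap p q r s}
    {a : List (Fin p × Fin q) → Matrix (Fin r) (Fin s) ℂ} (h : IsSchurSeries a f) :
    ‖a []‖ ≤ 1 := by
  refine (norm_le_norm_const_one _).trans ?_
  rw [← h.map_zero]
  exact h.contraction 1 0 (by simp)

/-- Composition of an NC analytic contraction valued map with a Möbius map. The Taylor
coefficients of `h = u (1 - v^* u)⁻¹` along each line satisfy the recursion given by
`h = u + h v^* u`, so inductively they are homogeneous NC polynomials. -/
theorem IsNCAnalyticOnBall.linFrac_comp {f : NCMap p q r s} (hf : IsNCAnalyticOnBall f)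
    (hc : IsContractionValued f) {v : Matrix (Fin r) (Fin s) ℂ} (hv : ‖v‖ < 1) :
    IsNCAnalyticOnBall fun n X => linFrac v (f n X) := by
  obtain ⟨a, ha⟩ := exists_isSchurSeries hf hc
  have hunit : ∀ n (X : NCMat p q n), ‖X‖ < 1 →
      IsUnit (1 - (NCMat.const v n)ᴴ * f n X) := fun n X hX =>
    isUnit_one_sub_mul ((NCMat.norm_const_le v n).trans_lt hv) (hc n X hX)
  set h : NCMap p q r s := fun n X => f n X * (1 - (NCMat.const v n)ᴴ * f n X)⁻¹ with hh
  have hrec : ∀ n (X : NCMat p q n), ‖X‖ < 1 →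
      f n X + h n X * (NCMat.const vᴴ n * f n X) = h n X := by
    intro n X hX
    have h1 : h n X * (1 - (NCMat.const v n)ᴴ * f n X) = f n X := by
      rw [hh, Matrix.mul_assoc, Matrix.nonsing_inv_mul _
        ((Matrix.isUnit_iff_isUnit_det _).1 (hunit n X hX)), Matrix.mul_one]
    rw [Matrix.mul_sub, Matrix.mul_one, sub_eq_iff_eq_add, NCMat.const_conjTranspose] at h1
    exact h1.symm
  have hex : ∀ n (X : NCMat p q n), ∃ c : ℕ → NCMat r s n, ‖X‖ < 1 →
      HasSum c (h n X) ∧ ∀ m, c m = ncHomPart a m X +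
        ∑ k ∈ Finset.HasAntidiagonal.antidiagonal m,
          c k.1 * (NCMat.const vᴴ n * ncHomPart a k.2 X) := by
    intro n X
    by_cases hX : ‖X‖ < 1
    swap
    · exact ⟨0, fun h => absurd h hX⟩
    obtain ⟨R, hR, hXR⟩ := exists_radius hX
    have hu := hf.differentiableOn_slice (zero_lt_one.trans hR) hXR
    have hd : DifferentiableOn ℂ (fun z : ℂ => h n (z • X)) (Metric.ball 0 R) :=
      hu.matrix_mul (((differentiableOn_const _).sub
        ((differentiableOn_const _).matrix_mul hu)).matrix_inv fun z hz => hunit n _ (hXR z hz))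
    obtain ⟨c, hcs⟩ := exists_taylor hd
    refine ⟨c, fun _ => ⟨by simpa using hcs 1 (by simpa using hR), powerSeries_coeff_unique ?_⟩⟩
    filter_upwards [Metric.ball_mem_nhds (0 : ℂ) (zero_lt_one.trans hR)] with z hz
    refine ⟨h n (z • X), hcs z hz, ?_⟩
    have hfz := ha.hasSum n _ (hXR z hz)
    have h2 := hfz.add ((hcs z hz).matrix_cauchyProduct (hfz.const_matrix_mul (NCMat.const vᴴ n)))
    rw [hrec n _ (hXR z hz)] at h2
    convert! h2 using 2 with m
    rw [smul_add, ncHomPart_smul, Finset.smul_sum]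
    congr 1
    refine Finset.sum_congr rfl fun k hk => ?_
    rw [ncHomPart_smul, Matrix.mul_smul, Matrix.smul_mul, Matrix.mul_smul, smul_smul, ← pow_add,
      Finset.HasAntidiagonal.mem_antidiagonal.1 hk]
  choose c hcc using hex
  -- The recursion has `c m` on both sides; solving it needs the inverse of `1 - v^* a []`.
  have hpoly : ∀ m, ∃ b : List (Fin p × Fin q) → Matrix (Fin r) (Fin s) ℂ,
      ∀ n (X : NCMat p q n), ‖X‖ < 1 → c n X m = ncHomPart b m X := by
    intro m
    induction m using Nat.strong_induction_on with
    | _ m ih =>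
    have ih' : ∀ k, ∃ b : List (Fin p × Fin q) → Matrix (Fin r) (Fin s) ℂ, k < m →
        ∀ n (X : NCMat p q n), ‖X‖ < 1 → c n X k = ncHomPart b k X := by
      intro k
      by_cases hk : k < m
      · obtain ⟨b, hb⟩ := ih k hk
        exact ⟨b, fun _ => hb⟩
      · exact ⟨0, fun h => absurd h hk⟩
    choose b hb using ih'
    set w0 : Matrix (Fin s) (Fin s) ℂ := 1 - vᴴ * a [] with hw0
    have hw0u : IsUnit w0.det := (Matrix.isUnit_iff_isUnit_det _).1
      (isUnit_one_sub_mul hv ha.norm_coeff_nil_le)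
    refine ⟨fun w => (a w + ∑ k ∈ Finset.range m, b k (w.take k) * (vᴴ * a (w.drop k))) * w0⁻¹,
      fun n X hX => ?_⟩
    have h1 := (hcc n X hX).2 m
    rw [Finset.Nat.sum_antidiagonal_eq_sum_range_succ
      (fun k l => c n X k * (NCMat.const vᴴ n * ncHomPart a l X)), Finset.sum_range_succ,
      Nat.sub_self, ncHomPart_zero, NCMat.const_mul_const, ← add_assoc] at h1
    have h2 : c n X m * NCMat.const w0 n = ncHomPart
        (fun w => a w + ∑ k ∈ Finset.range m, b k (w.take k) * (vᴴ * a (w.drop k))) m X := by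
      rw [hw0, NCMat.const_sub, NCMat.const_one, Matrix.mul_sub, Matrix.mul_one, sub_eq_iff_eq_add,
        ncHomPart_add]
      conv_lhs => rw [h1]
      congr 2
      have h3 : ncHomPart (fun w => ∑ k ∈ Finset.range m, b k (w.take k) * (vᴴ * a (w.drop k))) m X
          = ∑ k ∈ Finset.range m,
            ncHomPart (fun w => b k (w.take k) * (vᴴ * a (w.drop k))) m X := by
        have hsum : ∀ (S : Finset ℕ) (A : ℕ → List (Fin p × Fin q) → Matrix (Fin r) (Fin s) ℂ),
            ncHomPart (fun w => ∑ k ∈ S, A k w) m X = ∑ k ∈ S, ncHomPart (A k) m X := by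
          intro S A
          induction S using Finset.induction_on with
          | empty => simp [ncHomPart]
          | insert k S hk ih => simp only [Finset.sum_insert hk, ncHomPart_add, ih]
        exact hsum _ _
      rw [h3]
      refine Finset.sum_congr rfl fun k hk => ?_
      have hk' := Finset.mem_range.1 hk
      rw [hb k hk' n X hX, const_mul_ncHomPart, ncHomPart_mul, Nat.add_sub_of_le hk'.le]
    rw [← ncHomPart_mul_const, ← h2, Matrix.mul_assoc, NCMat.const_mul_const,
      Matrix.mul_nonsing_inv _ hw0u, NCMat.const_one, Matrix.mul_one]
  choose b hb using hpoly
  set D := CFC.sqrt (1 - v * vᴴ)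
  set D' := CFC.sqrt (1 - vᴴ * v)
  have hval : ∀ n (X : NCMat p q n), linFrac v (f n X) =
      NCMat.const v n + NCMat.const (-D) n * h n X * NCMat.const D' n := by
    intro n X
    have hneg : NCMat.const (-D) n = -NCMat.const D n := by
      rw [← zero_sub, NCMat.const_sub, NCMat.const_zero, zero_sub]
    have hhX : h n X = f n X * (1 - NCMat.const vᴴ n * f n X)⁻¹ := by
      simp only [hh, NCMat.const_conjTranspose]
    rw [hneg, linFrac, hhX, Matrix.neg_mul, Matrix.neg_mul,
      ← sub_eq_add_neg]
    simp only [Matrix.mul_assoc, D, D']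
  refine .of_hasSum (a := fun w => (if w = [] then v else 0) + -D * b w.length w * D')
    (fun n X hX => ?_) fun N n W α hW hW' hα hm => ?_
  · rw [hval]
    have h1 := ((hcc n X hX).1.const_matrix_mul (NCMat.const (-D) n)).matrix_mul_const
      (NCMat.const D' n)
    refine ((hasSum_ite_eq 0 (NCMat.const v n)).add h1).congr_fun ?_
    intro m
    rw [ncHomPart_add, ← ncHomPart_mul_const, ← const_mul_ncHomPart, hb m n X hX]
    congr 1
    · rcases Nat.eq_zero_or_pos m with rfl | hm
      · simp [ncHomPart_zero]
      · rw [if_neg hm.ne', ncHomPart_congr (b := 0)]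
        · simp [ncHomPart]
        · intro w hw
          rw [if_neg]
          · rfl
          · rintro rfl
            simp at hw
            omega
    · congr 2
      exact ncHomPart_congr (fun w hw => by rw [hw]) X
  · obtain ⟨h1, h2⟩ := hf.comp_analytic N n W α hW hW' hα hm
    simp only [linFrac_eq_moebius]
    exact ⟨(isDefectPair_linFrac hv n).differentiableOn h1 fun z hz => hc n _ (hm hz),
      fun hα' hm' => (isDefectPair_linFrac hv n).continuousOn (h2 hα' hm')
        fun z hz => hc n _ (hm' hz)⟩

lemma IsContractionValued.linFrac_comp {f : NCMap p q r s} (hc : IsContractionValued f)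
    {v : Matrix (Fin r) (Fin s) ℂ} (hv : ‖v‖ < 1) :
    IsContractionValued fun n X => linFrac v (f n X) := by
  intro n X hX
  simp only [linFrac_eq_moebius]
  exact (isDefectPair_linFrac hv n).norm_moebius_le (hc n X hX)

end Series

/-! ### Block diagonal matrices in rotated coordinates -/

section Split

open Matrix

variable {α α₁ α₂ β β₁ β₂ : Type*} [Fintype α] [DecidableEq α] [Fintype α₁] [DecidableEq α₁]
  [Fintype α₂] [DecidableEq α₂] [Fintype β] [DecidableEq β] [Fintype β₁] [DecidableEq β₁]
  [Fintype β₂] [DecidableEq β₂]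

/-- The matrix `[J K]` is unitary. -/
structure IsUnitarySplit (J : Matrix α α₁ ℂ) (K : Matrix α α₂ ℂ) : Prop where
  left : Jᴴ * J = 1
  right : Kᴴ * K = 1
  left_right : Jᴴ * K = 0
  add_eq_one : J * Jᴴ + K * Kᴴ = 1

namespace IsUnitarySplit

lemma right_left {J : Matrix α α₁ ℂ} {K : Matrix α α₂ ℂ} (h : IsUnitarySplit J K) :
    Kᴴ * J = 0 := by
  simpa using congrArg conjTranspose h.left_right

lemma const {p q r n : ℕ} {J : Matrix (Fin r) (Fin p) ℂ} {K : Matrix (Fin r) (Fin q) ℂ}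
    (h : IsUnitarySplit J K) : IsUnitarySplit (NCMat.const J n) (NCMat.const K n) where
  left := by rw [NCMat.const_conjTranspose, NCMat.const_mul_const, h.left, NCMat.const_one]
  right := by rw [NCMat.const_conjTranspose, NCMat.const_mul_const, h.right, NCMat.const_one]
  left_right := by
    rw [NCMat.const_conjTranspose, NCMat.const_mul_const, h.left_right, NCMat.const_zero]
  add_eq_one := by
    rw [NCMat.const_conjTranspose, NCMat.const_mul_const, NCMat.const_conjTranspose,
      NCMat.const_mul_const, ← NCMat.const_add, h.add_eq_one, NCMat.const_one]

variable {J' : Matrix α α₁ ℂ} {K' : Matrix α α₂ ℂ} {J : Matrix β β₁ ℂ} {K : Matrix β β₂ ℂ}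

lemma norm_blockSum_le (h' : IsUnitarySplit J' K') (h : IsUnitarySplit J K)
    {X : Matrix α₁ β₁ ℂ} {Y : Matrix α₂ β₂ ℂ} {c : ℝ} (hX : ‖X‖ ≤ c) (hY : ‖Y‖ ≤ c) :
    ‖J' * X * Jᴴ + K' * Y * Kᴴ‖ ≤ c := by
  have hc : 0 ≤ c := (norm_nonneg X).trans hX
  refine norm_le_of_norm_act_le hc fun k => ?_
  have e1 : (J' * X * Jᴴ + K' * Y * Kᴴ)ᴴ * (J' * X * Jᴴ + K' * Y * Kᴴ) =
      (X * Jᴴ)ᴴ * (X * Jᴴ) + (Y * Kᴴ)ᴴ * (Y * Kᴴ) := by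
    have a1 : ∀ Z : Matrix α₁ β ℂ, J'ᴴ * (J' * Z) = Z := fun Z => by
      rw [← Matrix.mul_assoc, h'.left, Matrix.one_mul]
    have a2 : ∀ Z : Matrix α₂ β ℂ, K'ᴴ * (K' * Z) = Z := fun Z => by
      rw [← Matrix.mul_assoc, h'.right, Matrix.one_mul]
    have a3 : ∀ Z : Matrix α₂ β ℂ, J'ᴴ * (K' * Z) = 0 := fun Z => by
      rw [← Matrix.mul_assoc, h'.left_right, Matrix.zero_mul]
    have a4 : ∀ Z : Matrix α₁ β ℂ, K'ᴴ * (J' * Z) = 0 := fun Z => by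
      rw [← Matrix.mul_assoc, h'.right_left, Matrix.zero_mul]
    simp only [conjTranspose_add, conjTranspose_mul, Matrix.add_mul, Matrix.mul_add,
      Matrix.mul_assoc, a1, a2, a3, a4, Matrix.mul_zero, add_zero, zero_add]
  have e2 : (Jᴴ)ᴴ * Jᴴ + (Kᴴ)ᴴ * Kᴴ = 1 := by simpa using h.add_eq_one
  have n1 : ‖act (J' * X * Jᴴ + K' * Y * Kᴴ) k‖ ^ 2 =
      ‖act X (act Jᴴ k)‖ ^ 2 + ‖act Y (act Kᴴ k)‖ ^ 2 := by
    rw [norm_act_sq, e1, ← act_mul, ← act_mul, norm_act_sq (X * Jᴴ), norm_act_sq (Y * Kᴴ), map_add,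
      _root_.add_apply, inner_add_right, Complex.add_re]
  have n2 : ‖k‖ ^ 2 = ‖act Jᴴ k‖ ^ 2 + ‖act Kᴴ k‖ ^ 2 := by
    rw [norm_act_sq, norm_act_sq, ← Complex.add_re, ← inner_add_right, ← _root_.add_apply,
      ← map_add, e2, act_one, inner_self_eq_norm_sq_to_K]
    norm_cast
  have b1 : ‖act X (act Jᴴ k)‖ ≤ c * ‖act Jᴴ k‖ := (norm_act_le _ _).trans (by gcongr)
  have b2 : ‖act Y (act Kᴴ k)‖ ≤ c * ‖act Kᴴ k‖ := (norm_act_le _ _).trans (by gcongr)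
  rw [← sq_le_sq₀ (norm_nonneg _) (by positivity), n1, mul_pow, n2, mul_add, ← mul_pow, ← mul_pow]
  gcongr

lemma norm_le_norm_blockSum (h' : IsUnitarySplit J' K') (h : IsUnitarySplit J K)
    (X : Matrix α₁ β₁ ℂ) (Y : Matrix α₂ β₂ ℂ) : ‖X‖ ≤ ‖J' * X * Jᴴ + K' * Y * Kᴴ‖ := by
  have e : X = J'ᴴ * (J' * X * Jᴴ + K' * Y * Kᴴ) * J := by
    have a1 : ∀ Z : Matrix α₁ β₁ ℂ, J'ᴴ * (J' * Z) = Z := fun Z => by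
      rw [← Matrix.mul_assoc, h'.left, Matrix.one_mul]
    simp only [Matrix.mul_add, Matrix.add_mul, Matrix.mul_assoc, h.left, h.right_left,
      Matrix.mul_one, a1, Matrix.mul_zero, add_zero]
  conv_lhs => rw [e]
  refine (l2_opNorm_mul _ _).trans ?_
  refine (mul_le_of_le_one_right (norm_nonneg _) (norm_le_one_of_isometry h.left)).trans ?_
  refine (l2_opNorm_mul _ _).trans (mul_le_of_le_one_left (norm_nonneg _) ?_)
  rw [l2_opNorm_conjTranspose]
  exact norm_le_one_of_isometry h'.left

end IsUnitarySplit

/-- The decomposition `p + (r - p) = r` of the indices. -/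
def sumFinEquiv {p r : ℕ} (h : p ≤ r) : Fin p ⊕ Fin (r - p) ≃ Fin r :=
  finSumFinEquiv.trans (finCongr (Nat.add_sub_of_le h))

/-- The first `p` columns of a matrix with `r` columns. -/
def leftCols {p r t : ℕ} (h : p ≤ r) (V : Matrix (Fin t) (Fin r) ℂ) : Matrix (Fin t) (Fin p) ℂ :=
  V.submatrix id (sumFinEquiv h ∘ Sum.inl)

/-- The last `r - p` columns of a matrix with `r` columns. -/
def rightCols {p r t : ℕ} (h : p ≤ r) (V : Matrix (Fin t) (Fin r) ℂ) :
    Matrix (Fin t) (Fin (r - p)) ℂ :=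
  V.submatrix id (sumFinEquiv h ∘ Sum.inr)

lemma fromCols_leftCols_rightCols {p r t : ℕ} (h : p ≤ r) (V : Matrix (Fin t) (Fin r) ℂ) :
    fromCols (leftCols h V) (rightCols h V) = V.submatrix id (sumFinEquiv h) := by
  ext i (j | j) <;> rfl

lemma isUnitarySplit_of_mem_unitaryGroup {p r : ℕ} (h : p ≤ r) {V : Matrix (Fin r) (Fin r) ℂ}
    (hV : V ∈ Matrix.unitaryGroup (Fin r) ℂ) : IsUnitarySplit (leftCols h V) (rightCols h V) := by
  have h1 : Vᴴ * V = 1 := (Matrix.mem_unitaryGroup_iff').1 hV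
  have h2 : V * Vᴴ = 1 := (Matrix.mem_unitaryGroup_iff).1 hV
  have e := fromCols_leftCols_rightCols h V
  have e1 : (fromCols (leftCols h V) (rightCols h V))ᴴ *
      fromCols (leftCols h V) (rightCols h V) = 1 := by
    rw [e, conjTranspose_submatrix, ← submatrix_mul _ _ _ id _ Function.bijective_id, h1,
      submatrix_one_equiv]
  have e2 : fromCols (leftCols h V) (rightCols h V) *
      (fromCols (leftCols h V) (rightCols h V))ᴴ = 1 := by
    rw [e, conjTranspose_submatrix, ← submatrix_mul _ _ _ (sumFinEquiv h) _ (Equiv.bijective _), h2,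
      submatrix_one _ Function.injective_id]
  rw [conjTranspose_fromCols_eq_fromRows_conjTranspose, fromRows_mul_fromCols, ← fromBlocks_one,
    fromBlocks_inj] at e1
  rw [conjTranspose_fromCols_eq_fromRows_conjTranspose, fromCols_mul_fromRows] at e2
  exact ⟨e1.1, e1.2.2.2, e1.2.1, e2⟩

lemma const_mul_blockDiag_mul_const {p q r s n : ℕ} (hr : p ≤ r) (hs : q ≤ s)
    (V : Matrix (Fin r) (Fin r) ℂ) (U : Matrix (Fin s) (Fin s) ℂ) (X : NCMat p q n)
    (Y : NCMat (r - p) (s - q) n) :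
    NCMat.const V n * NCMat.blockDiag hr hs X Y * NCMat.const Uᴴ n =
      NCMat.const (leftCols hr V) n * X * (NCMat.const (leftCols hs U) n)ᴴ +
        NCMat.const (rightCols hr V) n * Y * (NCMat.const (rightCols hs U) n)ᴴ := by
  have hc : ∀ {p r t : ℕ} (h : p ≤ r) (V : Matrix (Fin t) (Fin r) ℂ),
      (NCMat.const V n).submatrix id (NCMat.splitEquiv h n) =
        fromCols (NCMat.const (leftCols h V) n) (NCMat.const (rightCols h V) n) := by
    intro p r t h V
    ext ⟨i, a⟩ (⟨j, b⟩ | ⟨j, b⟩) <;> rfl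
  have h1 : NCMat.const V n * NCMat.blockDiag hr hs X Y * NCMat.const Uᴴ n =
      (NCMat.const V n).submatrix id (NCMat.splitEquiv hr n) * fromBlocks X 0 0 Y *
        ((NCMat.const U n).submatrix id (NCMat.splitEquiv hs n))ᴴ := by
    rw [← NCMat.const_conjTranspose, NCMat.blockDiag, reindex_apply, conjTranspose_submatrix]
    have h2 : fromBlocks X 0 0 Y = (submatrix (fromBlocks X 0 0 Y) (NCMat.splitEquiv hr n).symm
        (NCMat.splitEquiv hs n).symm).submatrix (NCMat.splitEquiv hr n)
        (NCMat.splitEquiv hs n) := by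
      rw [submatrix_submatrix]
      simp
    conv_rhs => rw [h2]
    rw [← submatrix_mul _ _ _ _ _ (Equiv.bijective _),
      ← submatrix_mul _ _ _ _ _ (Equiv.bijective _), submatrix_id_id]
  rw [h1, hc, hc, fromCols_mul_fromBlocks, conjTranspose_fromCols_eq_fromRows_conjTranspose,
    fromCols_mul_fromRows]
  simp

end Split

/-! ### Möbius images of block diagonal maps are NC ball maps -/

section BlockDiagonal

open Matrix

variable {p q r r' s s' : ℕ}

lemma norm_ncValueZero_eq {f : NCMap p q r s} {a : List (Fin p × Fin q) → Matrix (Fin r) (Fin s) ℂ}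
    (h : IsSchurSeries a f) : ‖ncValueZero f‖ = ‖f 1 0‖ := by
  rw [h.ncValueZero_eq, h.map_zero]
  exact (norm_le_norm_const_one _).antisymm (NCMat.norm_const_le _ _)

/-- If `u` is block diagonal with first block `X` in the coordinates given by the unitary matrices
`[J' K']` and `[J K]`, then `F_v ∘ u` is an NC ball map. -/
theorem isNCBallMap_linFrac_blockSum {v : Matrix (Fin r) (Fin s) ℂ} (hv : ‖v‖ < 1)
    {J' : Matrix (Fin r) (Fin p) ℂ} {K' : Matrix (Fin r) (Fin r') ℂ}
    {J : Matrix (Fin s) (Fin q) ℂ} {K : Matrix (Fin s) (Fin s') ℂ}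
    (h' : IsUnitarySplit J' K') (h : IsUnitarySplit J K)
    {ψ : NCMap p q r' s'} (hψ : IsNCAnalyticOnBall ψ) (hψc : IsContractionValued ψ)
    (hψ0 : ‖ncValueZero ψ‖ < 1) {f : NCMap p q r s}
    (hf : ∀ (n : ℕ) (X : NCMat p q n), ‖X‖ < 1 → f n X = linFrac v
      (NCMat.const J' n * X * (NCMat.const J n)ᴴ + NCMat.const K' n * ψ n X * (NCMat.const K n)ᴴ)) :
    IsNCBallMap f ∧ ‖ncValueZero f‖ ≠ 1 := by
  set u : NCMap p q r s := fun n X =>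
    NCMat.const J' n * X * (NCMat.const J n)ᴴ + NCMat.const K' n * ψ n X * (NCMat.const K n)ᴴ
    with hu
  have hua : IsNCAnalyticOnBall u := by
    simp only [hu, NCMat.const_conjTranspose]
    exact (isNCAnalyticOnBall_id.const_mul_mul_const J' Jᴴ).add (hψ.const_mul_mul_const K' Kᴴ)
  have huc : IsContractionValued u := fun n X hX =>
    h'.const.norm_blockSum_le h.const hX.le (hψc n X hX)
  have hfa : IsNCAnalyticOnBall f := (hua.linFrac_comp huc hv).congr hf
  have hfc : IsContractionValued f := fun n X hX => by
    rw [hf n X hX]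
    exact huc.linFrac_comp hv n X hX
  refine ⟨⟨hfa, hfc, fun n X t L hX hL => ?_⟩, ?_⟩
  · have hd := isDefectPair_linFrac hv n
    set Z : ℝ → NCMat p q n := fun ρ => ((ρ : ℂ) * Complex.exp (t * Complex.I)) • X with hZ
    have hρ : ∀ᶠ ρ : ℝ in 𝓝[<] 1, ρ ∈ Set.Ioo (0 : ℝ) 1 :=
      Ioo_mem_nhdsLT zero_lt_one
    have hnZ : ∀ ρ ∈ Set.Ioo (0 : ℝ) 1, ‖Z ρ‖ = ρ := fun ρ hρ => by
      rw [hZ, norm_smul, hX, norm_mul, Complex.norm_exp_ofReal_mul_I, Complex.norm_real,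
        Real.norm_of_nonneg hρ.1.le, mul_one, mul_one]
    have hfZ : ∀ ρ ∈ Set.Ioo (0 : ℝ) 1, ‖f n (Z ρ)‖ ≤ 1 := fun ρ hρ =>
      hfc n _ ((hnZ ρ hρ).trans_lt hρ.2)
    have hL1 : ‖L‖ ≤ 1 := le_of_tendsto hL.norm (hρ.mono hfZ)
    -- Applying the involution to the radial limit shows that `u` has a radial limit as well.
    have hlim : Tendsto (fun ρ => linFrac v (f n (Z ρ))) (𝓝[<] 1) (𝓝 (linFrac v L)) := by
      simp only [linFrac_eq_moebius]
      have hc : ContinuousOn (fun w : NCMat r s n => moebius (NCMat.const v n)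
          (NCMat.const (CFC.sqrt (1 - v * vᴴ)) n) (NCMat.const (CFC.sqrt (1 - vᴴ * v)) n) w)
          {w | ‖w‖ ≤ 1} := hd.continuousOn continuousOn_id fun w hw => hw
      exact (hc L hL1).tendsto.comp (tendsto_nhdsWithin_iff.2 ⟨hL, hρ.mono hfZ⟩)
    have hge : 1 ≤ ‖linFrac v L‖ := by
      have hid : Tendsto (fun ρ : ℝ => ρ) (𝓝[<] 1) (𝓝 1) := nhdsWithin_le_nhds
      refine le_of_tendsto_of_tendsto hid hlim.norm (hρ.mono fun ρ hρ' => ?_)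
      have hZ1 : ‖Z ρ‖ < 1 := (hnZ ρ hρ').trans_lt hρ'.2
      have h1 : linFrac v (f n (Z ρ)) = u n (Z ρ) := by
        rw [hf n _ hZ1, linFrac_eq_moebius, linFrac_eq_moebius]
        exact hd.moebius_moebius (huc n _ hZ1)
      change ρ ≤ ‖linFrac v (f n (Z ρ))‖
      rw [h1]
      exact (hnZ ρ hρ').ge.trans (h'.const.norm_le_norm_blockSum h.const (Z ρ) (ψ n (Z ρ)))
    rw [linFrac_eq_moebius] at hge
    exact (hd.norm_moebius_eq_one_iff hL1).1 ((hd.norm_moebius_le hL1).antisymm hge)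
  · obtain ⟨a, ha⟩ := exists_isSchurSeries hfa hfc
    obtain ⟨b, hb⟩ := exists_isSchurSeries hψ hψc
    have hu0 : ‖u 1 0‖ < 1 := (h'.const.norm_blockSum_le h.const
      (by rw [norm_zero]; exact norm_nonneg _) (norm_ncValueZero_eq hb).ge).trans_lt hψ0
    have hf0 : f 1 0 = linFrac v (u 1 0) := hf 1 0 (by rw [norm_zero]; exact one_pos)
    rw [norm_ncValueZero_eq ha, hf0, linFrac_eq_moebius]
    exact ((isDefectPair_linFrac hv 1).norm_moebius_lt hu0).ne

end BlockDiagonal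

/-! ### Rigidity of contraction valued power series -/

section Schwarz

variable {E : Type*} [NormedAddCommGroup E] [NormedSpace ℂ E] [CompleteSpace E]

lemma differentiableOn_and_hasDerivAt_of_hasSum {c : ℕ → E} {F : ℂ → E}
    (h : ∀ z ∈ Metric.ball (0 : ℂ) 1, HasSum (fun m => z ^ m • c m) (F z)) :
    DifferentiableOn ℂ F (Metric.ball 0 1) ∧ HasDerivAt F (c 1) 0 := by
  let P : FormalMultilinearSeries ℂ ℂ E := fun k =>
    ContinuousMultilinearMap.mkPiRing ℂ (Fin k) (c k)
  have hP : ∀ k, P.coeff k = c k := fun k => by simp [P, FormalMultilinearSeries.coeff]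
  have hB : HasFPowerSeriesOnBall F P 0 1 := by
    refine ⟨ENNReal.le_of_forall_nnreal_lt fun ρ hρ => ?_, one_pos, fun {y} hy => ?_⟩
    · have hρ' : ((ρ : ℝ) : ℂ) ∈ Metric.ball (0 : ℂ) 1 := by simpa using hρ
      apply FormalMultilinearSeries.le_radius_of_tendsto (l := 0)
      convert! tendsto_norm.comp (h _ hρ').summable.tendsto_atTop_zero using 2 with m
      · simp [norm_smul, P, mul_comm]
      · simp
    · have hy' : y ∈ Metric.ball (0 : ℂ) 1 := by
        rwa [← ENNReal.coe_one, Metric.eball_coe, NNReal.coe_one] at hy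
      simpa [hP] using h y hy'
  refine ⟨?_, ?_⟩
  · have := hB.differentiableOn
    rwa [← ENNReal.coe_one, Metric.eball_coe, NNReal.coe_one] at this
  · simpa [P] using hB.hasFPowerSeriesAt.hasDerivAt

lemma eq_zero_of_hasSum {c : ℕ → E} {F : ℂ → E}
    (h : ∀ z ∈ Metric.ball (0 : ℂ) 1, HasSum (fun m => z ^ m • c m) (F z)) : F 0 = c 0 := by
  have h1 := h 0 (by simp)
  refine h1.unique ?_
  convert! hasSum_single (f := fun m => (0 : ℂ) ^ m • c m) 0 fun m hm => by simp [hm] using 1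
  simp

lemma norm_coeff_one_le {c : ℕ → E} {F : ℂ → E}
    (h : ∀ z ∈ Metric.ball (0 : ℂ) 1, HasSum (fun m => z ^ m • c m) (F z)) (h0 : c 0 = 0)
    (h1 : ∀ z ∈ Metric.ball (0 : ℂ) 1, ‖F z‖ ≤ 1) : ‖c 1‖ ≤ 1 := by
  obtain ⟨hd, hd'⟩ := differentiableOn_and_hasDerivAt_of_hasSum h
  rw [← hd'.deriv]
  refine Complex.norm_deriv_le_one_of_mapsTo_ball hd (fun z hz => ?_) one_pos
  rw [eq_zero_of_hasSum h, h0]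
  simpa using h1 z hz

/-- The equality case of the Schwarz lemma, for the Taylor coefficients of a function into the
unit ball of a strictly convex space. -/
lemma coeff_eq_zero_of_norm_coeff_one_eq [StrictConvexSpace ℝ E] {c : ℕ → E} {F : ℂ → E}
    (h : ∀ z ∈ Metric.ball (0 : ℂ) 1, HasSum (fun m => z ^ m • c m) (F z)) (h0 : c 0 = 0)
    (h1 : ∀ z ∈ Metric.ball (0 : ℂ) 1, ‖F z‖ ≤ 1) (hc : ‖c 1‖ = 1) {m : ℕ} (hm : m ≠ 1) :
    c m = 0 := by
  obtain ⟨hd, hd'⟩ := differentiableOn_and_hasDerivAt_of_hasSum h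
  have hF0 : F 0 = 0 := (eq_zero_of_hasSum h).trans h0
  have hF := Complex.affine_of_mapsTo_ball_of_norm_dslope_eq_div (z₀ := 0) (R₂ := 1) hd
    (fun z hz => by rw [hF0]; simpa using h1 z hz) (by simp)
    (by rw [dslope_same, hd'.deriv, hc, div_one])
  have := powerSeries_coeff_unique (c := c) (c' := fun m => if m = 1 then c 1 else 0) ?_ m
  · simpa [hm] using this
  filter_upwards [Metric.ball_mem_nhds (0 : ℂ) one_pos] with z hz
  refine ⟨F z, h z hz, ?_⟩
  have hz' := hF hz
  simp only [hF0, dslope_same, hd'.deriv, sub_zero, zero_add] at hz'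
  rw [hz']
  convert! hasSum_ite_eq 1 (z • c 1) using 2 with k
  split_ifs with hk
  · rw [hk, pow_one]
  · simp

end Schwarz

section Inclusion

open Matrix

variable {α β γ : Type*} [Fintype α] [DecidableEq α] [Fintype β] [DecidableEq β]
  [Fintype γ] [DecidableEq γ]

/-- The matrix that maps the basis vector with index `j` to the one with index `e j`. -/
def inclusionMatrix (e : β → α) : Matrix α β ℂ := (1 : Matrix α α ℂ).submatrix id e

lemma inclusionMatrix_isometry {e : β → α} (he : Function.Injective e) :
    (inclusionMatrix e)ᴴ * inclusionMatrix e = 1 := by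
  rw [inclusionMatrix, conjTranspose_submatrix, conjTranspose_one,
    ← submatrix_mul _ _ _ _ _ Function.bijective_id, Matrix.one_mul, submatrix_one _ he]

lemma inclusionMatrix_orthogonal {e : β → α} {e' : γ → α} (h : ∀ j k, e j ≠ e' k) :
    (inclusionMatrix e)ᴴ * inclusionMatrix e' = 0 := by
  rw [inclusionMatrix, inclusionMatrix, conjTranspose_submatrix, conjTranspose_one,
    ← submatrix_mul _ _ _ _ _ Function.bijective_id, Matrix.one_mul]
  ext j k
  simp [h]

lemma mul_inclusionMatrix (A : Matrix γ α ℂ) (e : β → α) :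
    A * inclusionMatrix e = A.submatrix id e := by
  conv_lhs => rw [inclusionMatrix, ← submatrix_id_id A,
    ← submatrix_mul _ _ _ _ _ Function.bijective_id, Matrix.mul_one]

lemma conjTranspose_inclusionMatrix_mul (e : β → α) (A : Matrix α γ ℂ) :
    (inclusionMatrix e)ᴴ * A = A.submatrix e id := by
  conv_lhs => rw [inclusionMatrix, conjTranspose_submatrix, conjTranspose_one,
    ← submatrix_id_id A, ← submatrix_mul _ _ _ _ _ Function.bijective_id, Matrix.one_mul]

lemma inclusionMatrix_apply (e : β → α) (i : α) (j : β) :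
    inclusionMatrix e i j = if i = e j then 1 else 0 := by
  simp [inclusionMatrix, Matrix.one_apply]

end Inclusion

section Rigidity

open Matrix

variable {p q r s n : ℕ} {f : NCMap p q r s} {a : List (Fin p × Fin q) → Matrix (Fin r) (Fin s) ℂ}

lemma IsSchurSeries.hasSum_slice (h : IsSchurSeries a f) {X : NCMat p q n} (hX : ‖X‖ ≤ 1) {z : ℂ}
    (hz : z ∈ Metric.ball (0 : ℂ) 1) :
    HasSum (fun m => z ^ m • ncHomPart a m X) (f n (z • X)) := by
  simpa only [ncHomPart_smul] using h.hasSum n _ (smul_mem_ball hX hz)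

lemma IsSchurSeries.norm_linearPart_le (h : IsSchurSeries a f) (h0 : a [] = 0) {X : NCMat p q n}
    (hX : ‖X‖ ≤ 1) : ‖ncHomPart a 1 X‖ ≤ 1 :=
  norm_coeff_one_le (fun _ => h.hasSum_slice hX)
    (by rw [ncHomPart_zero, h0, NCMat.const_zero]) fun z hz =>
    h.contraction n _ (smul_mem_ball hX hz)

/-- The map `X ↦ f(X^*)^*`. -/
def adjMap (f : NCMap p q r s) : NCMap q p s r := fun n X => (f n Xᴴ)ᴴ

lemma IsSchurSeries.adjMap (h : IsSchurSeries a f) : IsSchurSeries (adjCoeff a) (adjMap f) where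
  hasSum n X hX := by
    have h1 := (h.hasSum n Xᴴ (by rwa [l2_opNorm_conjTranspose])).matrix_conjTranspose
    simp only [ncHomPart_conjTranspose, conjTranspose_conjTranspose] at h1
    exact h1
  contraction n X hX := by
    rw [_root_.adjMap, l2_opNorm_conjTranspose]
    exact h.contraction n _ (by rwa [l2_opNorm_conjTranspose])

/-- The coordinates `(j, b)` with `b < n`, at the level `n + k`. -/
def levelIncl (q n k : ℕ) (j : Fin q × Fin n) : Fin q × Fin (n + k) := (j.1, Fin.castAdd k j.2)

lemma levelIncl_injective (q n k : ℕ) : Function.Injective (levelIncl q n k) := by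
  rintro ⟨i, a⟩ ⟨j, b⟩ h
  simpa [levelIncl] using h

lemma const_mul_levelIncl (A : Matrix (Fin r) (Fin s) ℂ) (n k : ℕ) :
    NCMat.const A (n + k) * inclusionMatrix (levelIncl s n k) =
      inclusionMatrix (levelIncl r n k) * NCMat.const A n := by
  have h1 : NCMat.const A (n + k) * inclusionMatrix (levelIncl s n k) =
      ((1 : Matrix (Fin r) (Fin r) ℂ) * A) ⊗ₖ
        (inclusionMatrix (Fin.castAdd k : Fin n → Fin (n + k)) *
          (1 : Matrix (Fin n) (Fin n) ℂ)) := by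
    rw [mul_inclusionMatrix, Matrix.one_mul, Matrix.mul_one]
    rfl
  have h2 : inclusionMatrix (levelIncl r n k) =
      (1 : Matrix (Fin r) (Fin r) ℂ) ⊗ₖ inclusionMatrix (Fin.castAdd k : Fin n → Fin (n + k)) := by
    ext ⟨i, c⟩ ⟨j, b⟩
    simp [inclusionMatrix, levelIncl, Matrix.one_apply, Prod.ext_iff, ite_and]
    split_ifs <;> rfl
  rw [h1, h2, NCMat.const, ← Matrix.mul_kronecker_mul]

/-- Every contraction `X` is the upper part of an isometric column `Z`. The lower part is
`(1 - X^* X)^{1/2}`, placed in the first block row; there are `p` block rows of height `n + q n`, so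
that composing `Z` with a coordinate projection gives a tuple at the level `n + q n`. -/
lemma exists_isometric_dilation (hp : 0 < p) {X : NCMat p q n} (hX : ‖X‖ ≤ 1) :
    ∃ Z : Matrix (Fin p × Fin (n + q * n)) (Fin q × Fin n) ℂ, Zᴴ * Z = 1 ∧
      ∀ i b j, Z (i, Fin.castAdd (q * n) b) j = X (i, b) j := by
  set S : Matrix (Fin q × Fin n) (Fin q × Fin n) ℂ := CFC.sqrt (1 - Xᴴ * X) with hS
  have hSS : Sᴴ * S = 1 - Xᴴ * X := by
    rw [(CFC.sqrt_nonneg (1 - Xᴴ * X)).posSemidef.isHermitian.eq]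
    exact CFC.sqrt_mul_sqrt_self _ (one_sub_conjTranspose_mul_self_nonneg hX)
  set e : Fin q × Fin n → Fin p × Fin (n + q * n) := fun k =>
    (⟨0, hp⟩, Fin.natAdd n (finProdFinEquiv k)) with he
  have hei : Function.Injective e := fun k l h => by
    simpa [he] using h
  have hne : ∀ j k, levelIncl p n (q * n) j ≠ e k := fun j k h => by
    have h1 := congrArg (fun x : Fin p × Fin (n + q * n) => (x.2 : ℕ)) h
    simp only [levelIncl, he, Fin.val_castAdd, Fin.val_natAdd] at h1
    have := j.2.2
    omega
  have hort : (inclusionMatrix e)ᴴ * inclusionMatrix (levelIncl p n (q * n)) = 0 :=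
    inclusionMatrix_orthogonal fun k j => (hne j k).symm
  refine ⟨inclusionMatrix (levelIncl p n (q * n)) * X + inclusionMatrix e * S, ?_, ?_⟩
  · have a1 : ∀ Y : NCMat p q n, (inclusionMatrix (levelIncl p n (q * n)))ᴴ *
        (inclusionMatrix (levelIncl p n (q * n)) * Y) = Y := fun Y => by
      rw [← Matrix.mul_assoc, inclusionMatrix_isometry (levelIncl_injective _ _ _), Matrix.one_mul]
    have a2 : (inclusionMatrix e)ᴴ * (inclusionMatrix e * S) = S := by
      rw [← Matrix.mul_assoc, inclusionMatrix_isometry hei, Matrix.one_mul]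
    have a3 : (inclusionMatrix (levelIncl p n (q * n)))ᴴ * (inclusionMatrix e * S) = 0 := by
      rw [← Matrix.mul_assoc, inclusionMatrix_orthogonal hne, Matrix.zero_mul]
    have a4 : (inclusionMatrix e)ᴴ * (inclusionMatrix (levelIncl p n (q * n)) * X) = 0 := by
      rw [← Matrix.mul_assoc, hort, Matrix.zero_mul]
    simp only [conjTranspose_add, conjTranspose_mul, Matrix.add_mul, Matrix.mul_add,
      Matrix.mul_assoc, a1, a2, a3, a4, Matrix.mul_zero, add_zero, zero_add, hSS]
    abel
  · intro i b j
    have h1 := congrArg (fun M : NCMat p q n => M (i, b) j)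
      (conjTranspose_inclusionMatrix_mul (levelIncl p n (q * n))
        (inclusionMatrix (levelIncl p n (q * n)) * X + inclusionMatrix e * S))
    rw [Matrix.mul_add, ← Matrix.mul_assoc, ← Matrix.mul_assoc,
      inclusionMatrix_isometry (levelIncl_injective _ _ _), inclusionMatrix_orthogonal hne,
      Matrix.one_mul, Matrix.zero_mul, add_zero] at h1
    exact h1.symm

/-- If the linear part of a contraction valued power series agrees with `X` on the range of an
isometry `J`, then so does the whole series. After dilating `X` to an isometric column `Y`, the
slice `z ↦ f(z Y) J ξ` attains equality in the Schwarz lemma for every unit vector `ξ`. -/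
theorem IsSchurSeries.mul_const_eq (h : IsSchurSeries a f) (hp : 0 < p) (h0 : a [] = 0)
    {J : Matrix (Fin s) (Fin q) ℂ} {J' : Matrix (Fin r) (Fin p) ℂ} (hJ : Jᴴ * J = 1)
    (hJ' : J'ᴴ * J' = 1)
    (h1 : ∀ (n : ℕ) (X : NCMat p q n),
      ncHomPart a 1 X * NCMat.const J n = NCMat.const J' n * X)
    {X : NCMat p q n} (hX : ‖X‖ < 1) :
    f n X * NCMat.const J n = NCMat.const J' n * X := by
  have hcJ : ∀ n, (NCMat.const J n)ᴴ * NCMat.const J n = 1 := fun n => by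
    rw [NCMat.const_conjTranspose, NCMat.const_mul_const, hJ, NCMat.const_one]
  have hcJ' : ∀ n, (NCMat.const J' n)ᴴ * NCMat.const J' n = 1 := fun n => by
    rw [NCMat.const_conjTranspose, NCMat.const_mul_const, hJ', NCMat.const_one]
  set N := n + q * n with hN
  obtain ⟨Z, hZ, hZX⟩ : ∃ Z : Matrix (Fin p × Fin N) (Fin q × Fin n) ℂ, Zᴴ * Z = 1 ∧
      ∀ i b j, Z (i, Fin.castAdd (q * n) b) j = X (i, b) j := exists_isometric_dilation hp hX.le
  set G := inclusionMatrix (levelIncl q n (q * n)) with hG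
  have hGi : Gᴴ * G = 1 := inclusionMatrix_isometry (levelIncl_injective _ _ _)
  -- In block form `Y = [[X, 0], [*, 0]]`, so its words compress to those of `X`.
  set Y : NCMat p q N := Z * Gᴴ with hY
  have hY1 : ‖Y‖ ≤ 1 := by
    refine (l2_opNorm_mul _ _).trans (mul_le_one₀ (norm_le_one_of_isometry hZ) (norm_nonneg _) ?_)
    rw [l2_opNorm_conjTranspose]
    exact norm_le_one_of_isometry hGi
  have hYG : Y * G = Z := by rw [hY, Matrix.mul_assoc, hGi, Matrix.mul_one]
  have hvanish : ∀ m, m ≠ 1 → ncHomPart a m Y * NCMat.const J N * G = 0 := by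
    intro m hm
    have hunit : ∀ ξ : EuclideanSpace ℂ (Fin q × Fin n), ‖ξ‖ = 1 →
        act (ncHomPart a m Y * NCMat.const J N * G) ξ = 0 := by
      intro ξ hξ
      have hJG : ‖act G ξ‖ = 1 := by rw [norm_act_of_isometry hGi, hξ]
      have hJG' : ‖act (NCMat.const J N) (act G ξ)‖ = 1 := by
        rw [norm_act_of_isometry (hcJ N), hJG]
      refine coeff_eq_zero_of_norm_coeff_one_eq
        (c := fun m => act (ncHomPart a m Y * NCMat.const J N * G) ξ)
        (F := fun z => act (f N (z • Y) * NCMat.const J N * G) ξ) ?_ ?_ ?_ ?_ hm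
      · intro z hz
        have hs := ((h.hasSum_slice hY1 hz).matrix_mul_const (NCMat.const J N)).matrix_mul_const G
        have hc : Continuous fun A : Matrix (Fin r × Fin N) (Fin q × Fin n) ℂ => act A ξ := by
          refine (PiLp.continuous_toLp 2 _).comp (continuous_pi fun i => ?_)
          exact continuous_finsetSum _ fun j _ =>
            (continuous_apply_apply i j).mul continuous_const
        have := hs.map (AddMonoidHom.mk' (fun A : Matrix (Fin r × Fin N) (Fin q × Fin n) ℂ =>
          act A ξ) fun A B => by rw [map_add, _root_.add_apply]) hc
        convert! this using 2 with k
        simp [Matrix.smul_mul]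
      · simp [ncHomPart_zero, h0, NCMat.const_zero]
      · intro z hz
        rw [act_mul, act_mul]
        refine (norm_act_le _ _).trans ?_
        rw [hJG', mul_one]
        exact h.contraction N _ (smul_mem_ball hY1 hz)
      · rw [h1, Matrix.mul_assoc, hYG, act_mul, norm_act_of_isometry (hcJ' N),
          norm_act_of_isometry hZ, hξ]
    refine (LinearEquiv.map_eq_zero_iff act).1 ?_
    ext1 ξ
    rcases eq_or_ne ξ 0 with rfl | hξ
    · simp
    have hξ' : ‖ξ‖ ≠ 0 := norm_ne_zero_iff.2 hξ
    have h2 := hunit (((‖ξ‖⁻¹ : ℝ) : ℂ) • ξ) (by simp [norm_smul, hξ'])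
    rw [map_smul] at h2
    exact (smul_eq_zero.1 h2).resolve_left (by simpa using hξ')
  have hcompress : ∀ m, (inclusionMatrix (levelIncl r n (q * n)))ᴴ * ncHomPart a m Y *
      inclusionMatrix (levelIncl s n (q * n)) = ncHomPart a m X := by
    intro m
    rw [conjTranspose_inclusionMatrix_mul, mul_inclusionMatrix]
    ext ⟨i, k⟩ ⟨j, l⟩
    refine ncHomPart_compress (X := X) (e := Fin.castAdd (q * n)) (Fin.castAdd_injective _ _)
      (fun i k j l => ?_) (fun i k j c hc => ?_) a m i k j l
    · have h2 := congrArg (fun M : Matrix (Fin p × Fin N) (Fin q × Fin n) ℂ =>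
        M (i, Fin.castAdd (q * n) k) (j, l)) hYG
      rw [hG, mul_inclusionMatrix] at h2
      exact h2.trans (hZX _ _ _)
    · rw [hY, Matrix.mul_apply]
      refine Finset.sum_eq_zero fun x _ => ?_
      rw [conjTranspose_apply, hG, inclusionMatrix_apply, if_neg, star_zero, mul_zero]
      rintro hjc
      exact hc ⟨x.2, (congrArg Prod.snd hjc).symm⟩
  have hzero : ∀ m, m ≠ 1 → ncHomPart a m X * NCMat.const J n = 0 := by
    intro m hm
    have h2 := hvanish m hm
    rw [Matrix.mul_assoc, const_mul_levelIncl] at h2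
    rw [← hcompress m, Matrix.mul_assoc, Matrix.mul_assoc, h2, Matrix.mul_zero]
  have hs := (h.hasSum n X hX).matrix_mul_const (NCMat.const J n)
  rw [← h1 n X]
  exact hs.unique (hasSum_single 1 hzero)

end Rigidity

/-! ### The linear part of an NC ball map fixing the origin -/

section LinearPart

open Matrix

/-- Equality in `‖∑ j, b i j‖ ≤ ∑ j, t j ≤ √q`, summed over `i`: by the variance identity
`∑ j k, ‖b j - b k‖² = 2 q ∑ j, ‖b j‖² - 2 ‖∑ j, b j‖²` the vectors `b i j` do not depend
on `j`. -/
lemma eq_and_norm_eq_of_sum_norm_sq {E : Type*} [NormedAddCommGroup E] [InnerProductSpace ℂ E]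
    {p q : ℕ} (hq : 0 < q) {b : Fin p → Fin q → E} {t : Fin q → ℝ}
    (hb : ∀ i j, ‖b i j‖ ≤ t j) (ht : ∑ j, t j ^ 2 ≤ 1)
    (h : ∑ i, ‖∑ j, b i j‖ ^ 2 = p * q) :
    (∀ i j k, b i j = b i k) ∧ ∀ i j, ‖b i j‖ = t j := by
  have hvar : ∀ u : Fin q → E, ∑ j, ∑ k, ‖u j - u k‖ ^ 2 =
      2 * q * ∑ j, ‖u j‖ ^ 2 - 2 * ‖∑ j, u j‖ ^ 2 := by
    intro u
    have h1 : ‖∑ j, u j‖ ^ 2 = ∑ j, ∑ k, (inner ℂ (u j) (u k)).re := by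
      have h2 := inner_self_eq_norm_sq (𝕜 := ℂ) (∑ j, u j)
      rw [sum_inner] at h2
      simp only [inner_sum] at h2
      rw [← h2]
      simp
    have h3 : ∀ j k, ‖u j - u k‖ ^ 2 =
        ‖u j‖ ^ 2 - 2 * (inner ℂ (u j) (u k)).re + ‖u k‖ ^ 2 := fun j k =>
      norm_sub_sq (𝕜 := ℂ) (u j) (u k)
    simp only [h3, h1, Finset.sum_add_distrib, Finset.sum_sub_distrib, Finset.sum_const,
      Finset.card_univ, Fintype.card_fin, nsmul_eq_mul, ← Finset.mul_sum]
    ring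
  have hle : ∀ i j, ‖b i j‖ ^ 2 ≤ t j ^ 2 := fun i j => by gcongr; exact hb i j
  have hle' : ∀ i, ∑ j, ‖b i j‖ ^ 2 ≤ ∑ j, t j ^ 2 := fun i => Finset.sum_le_sum fun j _ => hle i j
  have hq' : (0 : ℝ) < q := by exact_mod_cast hq
  have hnn : ∀ i, 0 ≤ ∑ j, ∑ k, ‖b i j - b i k‖ ^ 2 := fun i => by positivity
  have htot : ∑ i, ∑ j, ∑ k, ‖b i j - b i k‖ ^ 2 = 2 * q * ∑ i, ∑ j, ‖b i j‖ ^ 2 - 2 * (p * q) := by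
    simp only [hvar, Finset.sum_sub_distrib, ← Finset.mul_sum, h]
  have hup : ∑ i, ∑ j, ‖b i j‖ ^ 2 ≤ p := by
    calc ∑ i, ∑ j, ‖b i j‖ ^ 2 ≤ ∑ _i : Fin p, (1 : ℝ) :=
          Finset.sum_le_sum fun i _ => (hle' i).trans ht
      _ = p := by simp
  have hzero : ∑ i, ∑ j, ∑ k, ‖b i j - b i k‖ ^ 2 = 0 := by
    refine le_antisymm ?_ (Finset.sum_nonneg fun i _ => hnn i)
    rw [htot]
    nlinarith
  have hsum : ∑ i, ∑ j, ‖b i j‖ ^ 2 = p := by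
    rw [htot] at hzero
    have : (2 * q : ℝ) * (∑ i, ∑ j, ‖b i j‖ ^ 2 - p) = 0 := by linarith
    rcases mul_eq_zero.1 this with h1 | h1 <;> linarith
  refine ⟨fun i j k => ?_, fun i j => ?_⟩
  · have h1 := (Finset.sum_eq_zero_iff_of_nonneg fun i _ => hnn i).1 hzero i (Finset.mem_univ _)
    have h2 := (Finset.sum_eq_zero_iff_of_nonneg fun j _ => by positivity).1 h1 j
      (Finset.mem_univ _)
    have h3 := (Finset.sum_eq_zero_iff_of_nonneg fun k _ => by positivity).1 h2 k
      (Finset.mem_univ _)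
    exact sub_eq_zero.1 (norm_eq_zero.1 (pow_eq_zero_iff two_ne_zero |>.1 h3))
  · have h1 : ∑ i, ∑ j, (t j ^ 2 - ‖b i j‖ ^ 2) = 0 := by
      refine le_antisymm ?_ (Finset.sum_nonneg fun i _ => Finset.sum_nonneg fun j _ =>
        sub_nonneg.2 (hle i j))
      simp only [Finset.sum_sub_distrib, hsum]
      simp only [Finset.sum_const, Finset.card_univ, Fintype.card_fin, nsmul_eq_mul]
      have hp : (0 : ℝ) ≤ p := by positivity
      nlinarith
    have h2 := (Finset.sum_eq_zero_iff_of_nonneg fun i _ => Finset.sum_nonneg fun j _ =>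
        sub_nonneg.2 (hle i j)).1 h1 i (Finset.mem_univ _)
    have h3 := (Finset.sum_eq_zero_iff_of_nonneg fun j _ => sub_nonneg.2 (hle i j)).1 h2 j
      (Finset.mem_univ _)
    exact (sq_eq_sq₀ (norm_nonneg _) ((norm_nonneg _).trans (hb i j))).1 (by linarith)

variable {p q r s n : ℕ} {f : NCMap p q r s} {a : List (Fin p × Fin q) → Matrix (Fin r) (Fin s) ℂ}

/-- The column `(a_{i1}, …, a_{iq})` of linear coefficients is a contraction, as the value of the
linear part at the partial isometry whose `i`-th row has the entries `E_{jo}`, for a fixed index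
`o`, and whose other rows vanish. -/
lemma IsSchurSeries.sum_norm_act_coeff_sq_le (h : IsSchurSeries a f) (h0 : a [] = 0) (i : Fin p)
    (x : EuclideanSpace ℂ (Fin s)) : ∑ j, ‖act (a [(i, j)]) x‖ ^ 2 ≤ ‖x‖ ^ 2 := by
  rcases Nat.eq_zero_or_pos q with rfl | hq
  · simp
  set o : Fin q := ⟨0, hq⟩
  set X : NCMat p q q := inclusionMatrix (fun j : Fin q => (i, j)) *
    (inclusionMatrix fun j : Fin q => (j, o))ᴴ with hX
  have hX1 : ‖X‖ ≤ 1 := by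
    refine (l2_opNorm_mul _ _).trans (mul_le_one₀ (norm_le_one_of_isometry
      (inclusionMatrix_isometry fun j k h => (Prod.ext_iff.1 h).2)) (norm_nonneg _) ?_)
    rw [l2_opNorm_conjTranspose]
    exact norm_le_one_of_isometry (inclusionMatrix_isometry fun j k h => (Prod.ext_iff.1 h).1)
  have hXe : ∀ i' j c d, X (i', c) (j, d) = if i' = i ∧ c = j ∧ d = o then 1 else 0 := by
    intro i' j c d
    simp only [hX, Matrix.mul_apply, conjTranspose_apply, inclusionMatrix_apply, Prod.mk.injEq]
    rw [Finset.sum_eq_single j]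
    · by_cases h1 : i' = i <;> by_cases h2 : c = j <;> by_cases h3 : d = o <;> simp [h1, h2, h3]
    · intro k _ hk
      simp [hk.symm]
    · simp
  set y : EuclideanSpace ℂ (Fin s × Fin q) :=
    WithLp.toLp 2 fun l => if l.2 = o then x l.1 else 0 with hy
  have hyn : ‖y‖ = ‖x‖ := by
    rw [← sq_eq_sq₀ (norm_nonneg _) (norm_nonneg _), EuclideanSpace.norm_sq_eq,
      EuclideanSpace.norm_sq_eq, Fintype.sum_prod_type]
    refine Finset.sum_congr rfl fun l _ => ?_
    rw [Finset.sum_eq_single o]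
    · simp [hy]
    · intro d _ hd
      simp [hy, hd]
    · simp
  have hval : ∀ (l : Fin r) (j : Fin q), act (ncHomPart a 1 X) y (l, j) =
      act (a [(i, j)]) x l := by
    intro l j
    rw [ncHomPart_one, act_apply, act_apply, Fintype.sum_prod_type]
    refine Finset.sum_congr rfl fun m _ => ?_
    rw [Finset.sum_eq_single o]
    · simp only [Matrix.sum_apply, kroneckerMap_apply, NCMat.entry, Matrix.of_apply, hXe, hy]
      rw [Finset.sum_eq_single (i, j)]
      · simp
      · rintro ⟨i', j'⟩ - hne
        rw [if_neg, mul_zero]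
        rintro ⟨rfl, rfl, -⟩
        exact hne rfl
      · simp
    · intro d _ hd
      simp [hy, hd]
    · simp
  have h1 := (norm_act_le (ncHomPart a 1 X) y).trans
    (mul_le_of_le_one_left (norm_nonneg _) (h.norm_linearPart_le h0 hX1))
  rw [hyn, ← sq_le_sq₀ (norm_nonneg _) (norm_nonneg _), EuclideanSpace.norm_sq_eq,
    Fintype.sum_prod_type_right] at h1
  refine le_trans (le_of_eq ?_) h1
  refine Finset.sum_congr rfl fun j _ => ?_
  rw [EuclideanSpace.norm_sq_eq]
  exact Finset.sum_congr rfl fun l _ => by rw [hval]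

lemma IsSchurSeries.norm_act_coeff_le (h : IsSchurSeries a f) (h0 : a [] = 0) (i : Fin p)
    (j : Fin q) (x : EuclideanSpace ℂ (Fin s)) : ‖act (a [(i, j)]) x‖ ≤ ‖x‖ := by
  rw [← sq_le_sq₀ (norm_nonneg _) (norm_nonneg _)]
  exact (Finset.single_le_sum (f := fun j => ‖act (a [(i, j)]) x‖ ^ 2)
    (fun j _ => by positivity) (Finset.mem_univ j)).trans (h.sum_norm_act_coeff_sq_le h0 i x)

lemma IsSchurSeries.act_coeff_eq_zero (h : IsSchurSeries a f) (h0 : a [] = 0) {i : Fin p}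
    {j k : Fin q} (hjk : k ≠ j) {x : EuclideanSpace ℂ (Fin s)} (hx : ‖act (a [(i, j)]) x‖ = ‖x‖) :
    act (a [(i, k)]) x = 0 := by
  have h1 := h.sum_norm_act_coeff_sq_le h0 i x
  have h2 := Finset.add_le_sum (f := fun j => ‖act (a [(i, j)]) x‖ ^ 2) (s := Finset.univ)
    (fun j _ => by positivity) (Finset.mem_univ j) (Finset.mem_univ k) hjk.symm
  simp only [hx] at h2
  have h3 : ‖act (a [(i, k)]) x‖ ^ 2 = 0 := le_antisymm (by linarith) (by positivity)
  simpa using h3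

/-- The matrix `∑ x_{ij} E_{ij}` at the tuple of matrix units `X_{ij} = E_{i'j'}` of size `q + p`,
where `j' = j` and `i' = q + i`. It has rank one, and all products of two entries vanish. -/
def rankOneTuple (p q : ℕ) : NCMat p q (q + p) :=
  Matrix.vecMulVec (fun k => if k.2 = Fin.natAdd q k.1 then 1 else 0)
    (fun l => if l.2 = Fin.castAdd p l.1 then 1 else 0)

lemma rankOneTuple_entry (k : Fin p × Fin q) : (rankOneTuple p q).entry k =
    Matrix.single (Fin.natAdd q k.1) (Fin.castAdd p k.2) 1 := by
  ext c d
  simp only [rankOneTuple, NCMat.entry, vecMulVec_apply, Matrix.single_apply, Matrix.of_apply,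
    eq_comm (b := c), eq_comm (b := d), mul_ite, mul_one, mul_zero]
  split_ifs <;> simp_all

lemma rankOneTuple_entry_mul (k l : Fin p × Fin q) :
    (rankOneTuple p q).entry k * (rankOneTuple p q).entry l = 0 := by
  rw [rankOneTuple_entry, rankOneTuple_entry, Matrix.single_mul_single_of_ne]
  intro h
  have := congrArg Fin.val h
  simp only [Fin.val_castAdd, Fin.val_natAdd] at this
  omega

lemma act_rankOneTuple_sq (x : EuclideanSpace ℂ (Fin q × Fin (q + p))) :
    ‖act (rankOneTuple p q) x‖ ^ 2 = p * ‖∑ j, x (j, Fin.castAdd p j)‖ ^ 2 := by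
  have h1 : ∀ k : Fin p × Fin (q + p), act (rankOneTuple p q) x k =
      if k.2 = Fin.natAdd q k.1 then ∑ j, x (j, Fin.castAdd p j) else 0 := by
    intro k
    rw [act_apply, Fintype.sum_prod_type]
    simp only [rankOneTuple, vecMulVec_apply]
    split_ifs with hk
    · simp
    · simp
  rw [EuclideanSpace.norm_sq_eq, Fintype.sum_prod_type]
  simp only [h1]
  have h2 : ∀ (i : Fin p) (z : ℂ), ∑ c : Fin (q + p),
      ‖(if c = Fin.natAdd q i then z else 0 : ℂ)‖ ^ 2 = ‖z‖ ^ 2 := by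
    intro i z
    rw [Finset.sum_eq_single (Fin.natAdd q i)]
    · simp
    · intro c _ hc
      simp [hc]
    · simp
  simp [h2]

lemma norm_rankOneTuple_sq (hq : 0 < q) : ‖rankOneTuple p q‖ ^ 2 = p * q := by
  have hq' : (0 : ℝ) < q := by exact_mod_cast hq
  refine le_antisymm ?_ ?_
  · have h1 : ‖rankOneTuple p q‖ ≤ √(p * q) := by
      refine norm_le_of_norm_act_le (Real.sqrt_nonneg _) fun x => ?_
      rw [← sq_le_sq₀ (norm_nonneg _) (by positivity), act_rankOneTuple_sq, mul_pow,
        Real.sq_sqrt (by positivity), mul_assoc]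
      gcongr
      have h2 : ‖∑ j, x (j, Fin.castAdd p j)‖ ^ 2 ≤ q * ∑ j, ‖x (j, Fin.castAdd p j)‖ ^ 2 := by
        have h3 := sq_sum_le_card_mul_sum_sq (s := Finset.univ)
          (f := fun j : Fin q => ‖x (j, Fin.castAdd p j)‖)
        rw [Finset.card_univ, Fintype.card_fin] at h3
        refine le_trans ?_ h3
        gcongr
        exact norm_sum_le _ _
      refine h2.trans (mul_le_mul_of_nonneg_left ?_ hq'.le)
      rw [EuclideanSpace.norm_sq_eq, Fintype.sum_prod_type]
      exact Finset.sum_le_sum fun j _ => Finset.single_le_sum (f := fun c => ‖x (j, c)‖ ^ 2)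
        (fun c _ => by positivity) (Finset.mem_univ (Fin.castAdd p j))
    exact (pow_le_pow_left₀ (norm_nonneg _) h1 2).trans_eq (Real.sq_sqrt (by positivity))
  · set x : EuclideanSpace ℂ (Fin q × Fin (q + p)) :=
      WithLp.toLp 2 fun l => if l.2 = Fin.castAdd p l.1 then 1 else 0 with hx
    have hxn : ‖x‖ ^ 2 = q := by
      rw [EuclideanSpace.norm_sq_eq, Fintype.sum_prod_type]
      have : ∀ j : Fin q, ∑ c, ‖x (j, c)‖ ^ 2 = 1 := by
        intro j
        rw [Finset.sum_eq_single (Fin.castAdd p j)]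
        · simp [hx]
        · intro c _ hc
          simp [hx, hc]
        · simp
      simp [this]
    have h1 := norm_act_le (rankOneTuple p q) x
    rw [← sq_le_sq₀ (norm_nonneg _) (by positivity), act_rankOneTuple_sq, mul_pow, hxn] at h1
    simp only [hx, if_true, Finset.sum_const, Finset.card_univ, Fintype.card_fin, nsmul_eq_mul,
      mul_one, Complex.norm_natCast] at h1
    rw [sq (q : ℝ), ← mul_assoc] at h1
    exact le_of_mul_le_mul_right h1 hq'

lemma act_kronecker_single (A : Matrix (Fin r) (Fin s) ℂ) (c₀ d₀ : Fin n)
    (w : EuclideanSpace ℂ (Fin s × Fin n)) (l : Fin r) (c : Fin n) :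
    act (A ⊗ₖ Matrix.single c₀ d₀ (1 : ℂ)) w (l, c) =
      if c = c₀ then act A (WithLp.toLp 2 fun m => w (m, d₀)) l else 0 := by
  rw [act_apply, act_apply, Fintype.sum_prod_type]
  split_ifs with hc
  · refine Finset.sum_congr rfl fun m _ => ?_
    rw [Finset.sum_eq_single d₀]
    · simp [hc]
    · intro d _ hd
      simp [hd.symm]
    · simp
  · refine Finset.sum_eq_zero fun m _ => Finset.sum_eq_zero fun d _ => ?_
    simp [Ne.symm hc]

/-- If the linear part attains its norm at the rank one tuple of matrix units, then there are
orthonormal families `x̂_j` and `ŷ_i` with `a_{ij} x̂_k = δ_{jk} ŷ_i` and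
`a_{ij}^* ŷ_k = δ_{ik} x̂_j`; they are the columns of `J` and `J'`. -/
theorem IsSchurSeries.exists_isometries (h : IsSchurSeries a f) (h0 : a [] = 0) (hp : 0 < p)
    (hq : 0 < q) (hnorm : ‖ncHomPart a 1 (rankOneTuple p q)‖ ^ 2 = p * q) :
    ∃ (J : Matrix (Fin s) (Fin q) ℂ) (J' : Matrix (Fin r) (Fin p) ℂ), Jᴴ * J = 1 ∧ J'ᴴ * J' = 1 ∧
      (∀ k, a [k] * J = J' * (Matrix.single k.1 k.2 1 : Matrix (Fin p) (Fin q) ℂ)) ∧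
      ∀ k, (a [k])ᴴ * J' = J * (Matrix.single k.2 k.1 1 : Matrix (Fin q) (Fin p) ℂ) := by
  have hp' : (0 : ℝ) < p := by exact_mod_cast hp
  have hq' : (0 : ℝ) < q := by exact_mod_cast hq
  have hne : Nonempty (Fin s × Fin (q + p)) := by
    by_contra hcon
    rw [not_nonempty_iff] at hcon
    have : ncHomPart a 1 (rankOneTuple p q) = 0 := by
      ext i j
      exact isEmptyElim j
    rw [this, norm_zero] at hnorm
    have : (0 : ℝ) < p * q := by positivity
    simp only [ne_eq, OfNat.ofNat_ne_zero, not_false_eq_true, zero_pow] at hnorm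
    linarith
  obtain ⟨w, hw1, hw⟩ := exists_norm_act_eq (ncHomPart a 1 (rankOneTuple p q))
  set x : Fin q → EuclideanSpace ℂ (Fin s) := fun j =>
    WithLp.toLp 2 fun l => w (l, Fin.castAdd p j) with hx
  have hact : ∀ l c, act (ncHomPart a 1 (rankOneTuple p q)) w (l, c) =
      ∑ i, if c = Fin.natAdd q i then (∑ j, act (a [(i, j)]) (x j)) l else 0 := by
    intro l c
    rw [ncHomPart_one, map_sum, _root_.sum_apply, WithLp.ofLp_sum, Finset.sum_apply,
      Fintype.sum_prod_type]
    refine Finset.sum_congr rfl fun i _ => ?_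
    have h1 : ∀ j, act (a [(i, j)] ⊗ₖ (rankOneTuple p q).entry (i, j)) w (l, c) =
        if c = Fin.natAdd q i then act (a [(i, j)]) (x j) l else 0 := fun j => by
      rw [rankOneTuple_entry, act_kronecker_single]
    simp only [h1]
    split_ifs
    · rw [WithLp.ofLp_sum, Finset.sum_apply]
    · simp
  have hsq : ∑ i, ‖∑ j, act (a [(i, j)]) (x j)‖ ^ 2 = p * q := by
    rw [← hnorm, ← hw, EuclideanSpace.norm_sq_eq, Fintype.sum_prod_type_right, Fin.sum_univ_add]
    have e1 : ∀ (j : Fin q) l, act (ncHomPart a 1 (rankOneTuple p q)) w (l, Fin.castAdd p j) =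
        0 := by
      intro j l
      rw [hact]
      refine Finset.sum_eq_zero fun i _ => if_neg fun hij => ?_
      have := congrArg Fin.val hij
      simp only [Fin.val_castAdd, Fin.val_natAdd] at this
      omega
    have e2 : ∀ (i : Fin p) l, act (ncHomPart a 1 (rankOneTuple p q)) w (l, Fin.natAdd q i) =
        (∑ j, act (a [(i, j)]) (x j)) l := by
      intro i l
      rw [hact, Finset.sum_eq_single i]
      · simp
      · intro i' _ hi
        simp [hi.symm]
      · simp
    simp only [e1, e2, norm_zero]
    simp [EuclideanSpace.norm_sq_eq]
  have ht : ∑ j, ‖x j‖ ^ 2 ≤ 1 := by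
    have h1 : ‖w‖ ^ 2 = 1 := by rw [hw1, one_pow]
    rw [← h1, EuclideanSpace.norm_sq_eq, Fintype.sum_prod_type_right, Fin.sum_univ_add]
    refine le_add_of_le_of_nonneg (le_of_eq ?_) (by positivity)
    exact Finset.sum_congr rfl fun j _ => by rw [EuclideanSpace.norm_sq_eq]
  -- The components `x j` of a norming vector realize equality in all triangle inequalities.
  obtain ⟨hconst, hnormeq⟩ := eq_and_norm_eq_of_sum_norm_sq hq
    (fun i j => h.norm_act_coeff_le h0 i j (x j)) ht hsq
  set i₀ : Fin p := ⟨0, hp⟩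
  set j₀ : Fin q := ⟨0, hq⟩
  set y : Fin p → EuclideanSpace ℂ (Fin r) := fun i => act (a [(i, j₀)]) (x j₀) with hy
  have hxy : ∀ i j, act (a [(i, j)]) (x j) = y i := fun i j => hconst i j j₀
  have hnx : ∀ i j, ‖y i‖ = ‖x j‖ := fun i j => by rw [← hxy i j, hnormeq]
  set c := ‖x j₀‖ with hc
  have hcx : ∀ j, ‖x j‖ = c := fun j => by rw [← hnx i₀, hnx i₀ j₀]
  have hcy : ∀ i, ‖y i‖ = c := fun i => hnx i j₀
  have hc0 : c ≠ 0 := by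
    intro hc0
    have h1 : ∑ i, ‖∑ j, act (a [(i, j)]) (x j)‖ ^ 2 = 0 := by
      refine Finset.sum_eq_zero fun i _ => ?_
      have h2 : ∀ j, act (a [(i, j)]) (x j) = 0 := fun j => by
        rw [hxy, ← norm_eq_zero, hcy, hc0]
      rw [Finset.sum_eq_zero fun j _ => h2 j, norm_zero, zero_pow two_ne_zero]
    rw [h1] at hsq
    have : (0 : ℝ) < p * q := by positivity
    linarith
  set xh : Fin q → EuclideanSpace ℂ (Fin s) := fun j => ((c⁻¹ : ℝ) : ℂ) • x j with hxh
  set yh : Fin p → EuclideanSpace ℂ (Fin r) := fun i => ((c⁻¹ : ℝ) : ℂ) • y i with hyh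
  have hcc : ‖((c⁻¹ : ℝ) : ℂ)‖ = c⁻¹ := by
    rw [Complex.norm_real, Real.norm_of_nonneg (inv_nonneg.2 (norm_nonneg _))]
  have hx1 : ∀ j, ‖xh j‖ = 1 := fun j => by
    rw [hxh, norm_smul, hcx, hcc, inv_mul_cancel₀ hc0]
  have hy1 : ∀ i, ‖yh i‖ = 1 := fun i => by
    rw [hyh, norm_smul, hcy, hcc, inv_mul_cancel₀ hc0]
  have hxyh : ∀ i j, act (a [(i, j)]) (xh j) = yh i := fun i j => by
    rw [hxh, map_smul, hxy]
  have hxy0 : ∀ i j k, k ≠ j → act (a [(i, k)]) (xh j) = 0 := fun i j k hk =>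
    h.act_coeff_eq_zero h0 hk (by rw [hxyh, hx1, hy1])
  have hadj := h.adjMap
  have ha0 : adjCoeff a [] = 0 := by simp [adjCoeff, h0]
  have hadjc : ∀ i j, adjCoeff a [(j, i)] = (a [(i, j)])ᴴ := fun i j => by simp [adjCoeff]
  -- A contraction that maps one unit vector to another is inverted there by its adjoint.
  have hyx : ∀ i j, act (a [(i, j)])ᴴ (yh i) = xh j := by
    intro i j
    have h1 : ‖act (a [(i, j)])ᴴ (yh i)‖ ≤ 1 := by
      rw [← hadjc, ← hy1 i]
      exact hadj.norm_act_coeff_le ha0 j i _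
    have h2 : inner ℂ (xh j) (act (a [(i, j)])ᴴ (yh i)) = 1 := by
      rw [← inner_act_left, hxyh, inner_self_eq_norm_sq_to_K, hy1]
      simp
    have h3 := norm_sub_sq (𝕜 := ℂ) (xh j) (act (a [(i, j)])ᴴ (yh i))
    rw [h2, hx1] at h3
    simp only [RCLike.one_re] at h3
    have h4 : ‖xh j - act (a [(i, j)])ᴴ (yh i)‖ ^ 2 = 0 :=
      le_antisymm (by nlinarith [norm_nonneg (act (a [(i, j)])ᴴ (yh i))]) (by positivity)
    exact (sub_eq_zero.1 (by simpa using h4)).symm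
  have hyx0 : ∀ i j k, k ≠ i → act (a [(k, j)])ᴴ (yh i) = 0 := fun i j k hk => by
    rw [← hadjc]
    exact hadj.act_coeff_eq_zero ha0 hk (by rw [hadjc, hyx, hx1, hy1])
  have hxo : ∀ j k, inner ℂ (xh j) (xh k) = if j = k then 1 else 0 := by
    intro j k
    split_ifs with hjk
    · rw [hjk, inner_self_eq_norm_sq_to_K, hx1]
      simp
    · rw [← hyx i₀ j, inner_act_left, conjTranspose_conjTranspose, hxy0 _ _ _ hjk, inner_zero_right]
  have hyo : ∀ i k, inner ℂ (yh i) (yh k) = if i = k then 1 else 0 := by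
    intro i k
    split_ifs with hik
    · rw [hik, inner_self_eq_norm_sq_to_K, hy1]
      simp
    · rw [← hxyh i j₀, inner_act_left, hyx0 _ _ _ hik, inner_zero_right]
  refine ⟨Matrix.of fun l j => xh j l, Matrix.of fun l i => yh i l, ?_, ?_, ?_, ?_⟩
  · ext j k
    rw [Matrix.one_apply, ← hxo]
    simp [Matrix.mul_apply, PiLp.inner_apply, mul_comm]
  · ext j k
    rw [Matrix.one_apply, ← hyo]
    simp [Matrix.mul_apply, PiLp.inner_apply, mul_comm]
  · rintro ⟨i, j⟩
    ext l k
    have h1 : (a [(i, j)] * (Matrix.of fun l j => xh j l)) l k = act (a [(i, j)]) (xh k) l := rfl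
    rw [h1]
    rcases eq_or_ne j k with rfl | hjk
    · rw [hxyh]
      simp
    · rw [hxy0 _ _ _ hjk]
      simp [hjk.symm]
  · rintro ⟨i, j⟩
    ext l k
    have h1 : ((a [(i, j)])ᴴ * (Matrix.of fun l j => yh j l)) l k =
      act (a [(i, j)])ᴴ (yh k) l := rfl
    rw [h1]
    rcases eq_or_ne i k with rfl | hik
    · rw [hyx]
      simp
    · rw [hyx0 _ _ _ hik]
      simp [hik.symm]

end LinearPart

/-! ### The structure of NC ball maps -/

section Structure

open Matrix

/-- Completion of an isometry to a unitary matrix. -/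
lemma exists_unitary_leftCols {p r : ℕ} {J : Matrix (Fin r) (Fin p) ℂ} (hJ : Jᴴ * J = 1) :
    ∃ h : p ≤ r, ∃ V ∈ Matrix.unitaryGroup (Fin r) ℂ, leftCols h V = J := by
  set x : Fin p → EuclideanSpace ℂ (Fin r) := fun j => WithLp.toLp 2 fun l => J l j with hx
  have hinner : ∀ j k, inner ℂ (x j) (x k) = if j = k then 1 else 0 := by
    intro j k
    rw [← Matrix.one_apply, ← hJ]
    simp [hx, Matrix.mul_apply, PiLp.inner_apply, mul_comm]
  have hox : Orthonormal ℂ x := orthonormal_iff_ite.2 hinner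
  have h : p ≤ r := by
    have := hox.linearIndependent.fintype_card_le_finrank
    simpa using this
  set v : Fin r → EuclideanSpace ℂ (Fin r) := fun l =>
    Sum.elim x (fun _ => 0) ((sumFinEquiv h).symm l) with hv
  set S : Set (Fin r) := Set.range (sumFinEquiv h ∘ Sum.inl) with hS
  have hvx : ∀ j, v (sumFinEquiv h (Sum.inl j)) = x j := fun j => by simp [hv]
  have hvo : Orthonormal ℂ (S.domRestrict v) := by
    rw [orthonormal_iff_ite]
    rintro ⟨_, j, rfl⟩ ⟨_, k, rfl⟩
    have h1 : inner ℂ (v (sumFinEquiv h (Sum.inl j))) (v (sumFinEquiv h (Sum.inl k))) =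
        if j = k then 1 else 0 := by rw [hvx, hvx, hinner]
    refine Eq.trans h1 ?_
    simp [Subtype.ext_iff]
  obtain ⟨b, hb⟩ := hvo.exists_orthonormalBasis_extension_of_card_eq (by simp)
  refine ⟨h, Matrix.of fun l m => b m l, ?_, ?_⟩
  · rw [Matrix.mem_unitaryGroup_iff']
    ext j k
    rw [Matrix.one_apply, ← orthonormal_iff_ite.1 b.orthonormal j k]
    simp [Matrix.mul_apply, Matrix.star_apply, PiLp.inner_apply, mul_comm]
  · ext l j
    have := hb (sumFinEquiv h (Sum.inl j)) ⟨j, rfl⟩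
    rw [hvx] at this
    simp [leftCols, this, hx]

variable {p q r s : ℕ}

/-- A contraction valued power series whose linear part attains its norm at the rank one tuple is,
in suitable coordinates, block diagonal with the identity map as its first block. -/
theorem IsSchurSeries.exists_blockDiag {φ : NCMap p q r s}
    {a : List (Fin p × Fin q) → Matrix (Fin r) (Fin s) ℂ} (h : IsSchurSeries a φ)
    (ha : IsNCAnalyticOnBall φ) (h0 : a [] = 0) (hp : 0 < p) (hq : 0 < q)
    (hnorm : ‖ncHomPart a 1 (rankOneTuple p q)‖ ^ 2 = p * q) :
    ∃ (hr : p ≤ r) (hs : q ≤ s),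
      ∃ V ∈ Matrix.unitaryGroup (Fin r) ℂ, ∃ U ∈ Matrix.unitaryGroup (Fin s) ℂ,
      ∃ ψ : NCMap p q (r - p) (s - q),
        IsNCAnalyticOnBall ψ ∧ IsContractionValued ψ ∧ ‖ncValueZero ψ‖ < 1 ∧
        ∀ (n : ℕ) (X : NCMat p q n), ‖X‖ < 1 →
          φ n X = NCMat.const V n * NCMat.blockDiag hr hs X (ψ n X) *
            NCMat.const Uᴴ n := by
  obtain ⟨J, J', hJ, hJ', h1, h2⟩ := h.exists_isometries h0 hp hq hnorm
  have lin1 : ∀ {p q r s : ℕ} {a : List (Fin p × Fin q) → Matrix (Fin r) (Fin s) ℂ}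
      {J : Matrix (Fin s) (Fin q) ℂ} {J' : Matrix (Fin r) (Fin p) ℂ},
      (∀ k, a [k] * J = J' * (Matrix.single k.1 k.2 1 : Matrix (Fin p) (Fin q) ℂ)) →
      ∀ (n : ℕ) (X : NCMat p q n),
        ncHomPart a 1 X * NCMat.const J n = NCMat.const J' n * X := by
    intro p q r s a J J' h1 n X
    have hid : X = ncHomPart idCoeff 1 X := by rw [ncHomPart_idCoeff, if_pos rfl]
    conv_rhs => rw [hid]
    rw [ncHomPart_mul_const, const_mul_ncHomPart, ncHomPart_one, ncHomPart_one]
    exact Finset.sum_congr rfl fun k _ => by rw [h1 k, idCoeff]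
  have hcol : ∀ n (X : NCMat p q n), ‖X‖ < 1 →
      φ n X * NCMat.const J n = NCMat.const J' n * X := fun n X hX =>
    h.mul_const_eq hp h0 hJ hJ' (lin1 h1) hX
  -- The rows of `φ` are the columns of `X ↦ φ(X^*)^*`.
  have h2' : ∀ k, adjCoeff a [k] * J' =
      J * (Matrix.single k.1 k.2 1 : Matrix (Fin q) (Fin p) ℂ) := fun k => by
    have := h2 k.swap
    simpa [adjCoeff] using this
  have hrow : ∀ n (X : NCMat p q n), ‖X‖ < 1 →
      (NCMat.const J' n)ᴴ * φ n X = X * (NCMat.const J n)ᴴ := by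
    intro n X hX
    have h3 := h.adjMap.mul_const_eq (X := Xᴴ) hq (by simp [adjCoeff, h0]) hJ' hJ (lin1 h2')
      (by rwa [l2_opNorm_conjTranspose])
    rw [_root_.adjMap, conjTranspose_conjTranspose] at h3
    simpa using congrArg conjTranspose h3
  obtain ⟨hr, V, hV, rfl⟩ := exists_unitary_leftCols hJ'
  obtain ⟨hs, U, hU, rfl⟩ := exists_unitary_leftCols hJ
  have sV := isUnitarySplit_of_mem_unitaryGroup hr hV
  have sU := isUnitarySplit_of_mem_unitaryGroup hs hU
  set K' := rightCols hr V
  set K := rightCols hs U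
  have hψa : IsNCAnalyticOnBall fun n X => NCMat.const K'ᴴ n * φ n X * NCMat.const K n :=
    ha.const_mul_mul_const K'ᴴ K
  have hψc : IsContractionValued fun n X => NCMat.const K'ᴴ n * φ n X * NCMat.const K n := by
    intro n X hX
    refine (l2_opNorm_mul _ _).trans (mul_le_one₀ ?_ (norm_nonneg _)
      (norm_le_one_of_isometry sU.const.right))
    refine (l2_opNorm_mul _ _).trans (mul_le_one₀ ?_ (norm_nonneg _) (h.contraction n X hX))
    rw [← NCMat.const_conjTranspose, l2_opNorm_conjTranspose]
    exact norm_le_one_of_isometry sV.const.right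
  refine ⟨hr, hs, V, hV, U, hU, _, hψa, hψc, ?_, fun n X hX => ?_⟩
  · obtain ⟨b, hb⟩ := exists_isSchurSeries hψa hψc
    rw [norm_ncValueZero_eq hb, h.map_zero, h0, NCMat.const_zero, Matrix.mul_zero, Matrix.zero_mul,
      norm_zero]
    exact one_pos
  · rw [const_mul_blockDiag_mul_const]
    have e1 := (sV.const (n := n)).add_eq_one
    have e2 := (sU.const (n := n)).add_eq_one
    have e3 := (sU.const (n := n)).left_right
    rw [← NCMat.const_conjTranspose]
    set cJ' := NCMat.const (leftCols hr V) n
    set cJ := NCMat.const (leftCols hs U) n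
    set cK' := NCMat.const K' n
    set cK := NCMat.const K n
    have e4 : cJ'ᴴ * (φ n X * cK) = 0 := by
      rw [← Matrix.mul_assoc, hrow n X hX, Matrix.mul_assoc, e3, Matrix.mul_zero]
    have e5 : φ n X * cK = cK' * (cK'ᴴ * (φ n X * cK)) := by
      conv_lhs => rw [← Matrix.one_mul (φ n X * cK), ← e1, Matrix.add_mul, Matrix.mul_assoc, e4,
        Matrix.mul_zero, zero_add, Matrix.mul_assoc]
    calc φ n X = φ n X * (cJ * cJᴴ + cK * cKᴴ) := by rw [e2, Matrix.mul_one]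
      _ = φ n X * cJ * cJᴴ + φ n X * cK * cKᴴ := by
        rw [Matrix.mul_add, Matrix.mul_assoc, Matrix.mul_assoc]
      _ = cJ' * X * cJᴴ + cK' * (cK'ᴴ * φ n X * cK) * cKᴴ := by
        rw [hcol n X hX]
        conv_lhs => rw [e5]
        rw [Matrix.mul_assoc cK'ᴴ]

lemma linFrac_linFrac {v : Matrix (Fin r) (Fin s) ℂ} (hv : ‖v‖ < 1) {n : ℕ} {u : NCMat r s n}
    (hu : ‖u‖ ≤ 1) : linFrac v (linFrac v u) = u := by
  simp only [linFrac_eq_moebius]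
  exact (isDefectPair_linFrac hv n).moebius_moebius hu

/-- At a nilpotent tuple of order two, `φ = F_v ∘ f` is linear along the complex line, so that `f`
has a radial limit; since it has norm one, so has the value of the linear part. -/
theorem IsNCBallMap.norm_linearPart_eq_one {f : NCMap p q r s} (hf : IsNCBallMap f)
    {v : Matrix (Fin r) (Fin s) ℂ} (hv : ‖v‖ < 1)
    {a : List (Fin p × Fin q) → Matrix (Fin r) (Fin s) ℂ}
    (ha : IsSchurSeries a fun n X => linFrac v (f n X)) (h0 : a [] = 0) {n : ℕ} {X : NCMat p q n}
    (hX : ‖X‖ = 1) (hnil : ∀ k l, X.entry k * X.entry l = 0) : ‖ncHomPart a 1 X‖ = 1 := by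
  have hd := isDefectPair_linFrac hv n
  have hle : ‖ncHomPart a 1 X‖ ≤ 1 := ha.norm_linearPart_le h0 hX.le
  have hline : ∀ z ∈ Metric.ball (0 : ℂ) 1, f n (z • X) = linFrac v (z • ncHomPart a 1 X) := by
    intro z hz
    have hzX := smul_mem_ball hX.le hz
    have h1 : HasSum (fun m => z ^ m • ncHomPart a m X) (z ^ 1 • ncHomPart a 1 X) := by
      refine hasSum_single 1 fun m hm => ?_
      rcases Nat.lt_or_ge m 2 with hm2 | hm2
      · have hm0 : m = 0 := by omega
        rw [hm0, ncHomPart_zero, h0, NCMat.const_zero, smul_zero]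
      · rw [ncHomPart_eq_zero_of_nilpotent a hm2 hnil, smul_zero]
    have h2 := (ha.hasSum_slice hX.le hz).unique h1
    rw [pow_one] at h2
    rw [← h2]
    exact (linFrac_linFrac hv (hf.contraction n _ hzX)).symm
  have hball : ∀ᶠ ρ : ℝ in 𝓝[<] 1, (ρ : ℂ) ∈ Metric.ball (0 : ℂ) 1 := by
    filter_upwards [Ioo_mem_nhdsLT (zero_lt_one' ℝ)] with ρ hρ
    rw [mem_ball_zero_iff, Complex.norm_real, Real.norm_of_nonneg hρ.1.le]
    exact hρ.2
  have hlim : Tendsto (fun ρ : ℝ => f n (((ρ : ℂ) * Complex.exp ((0 : ℝ) * Complex.I)) • X))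
      (𝓝[<] (1 : ℝ)) (𝓝 (linFrac v (ncHomPart a 1 X))) := by
    simp only [Complex.ofReal_zero, zero_mul, Complex.exp_zero, mul_one]
    have hc : ContinuousOn (fun w : NCMat r s n => linFrac v w) {w | ‖w‖ ≤ 1} := by
      simp only [linFrac_eq_moebius]
      exact hd.continuousOn continuousOn_id fun w hw => hw
    have h1 : Tendsto (fun ρ : ℝ => (ρ : ℂ) • ncHomPart a 1 X) (𝓝[<] 1) (𝓝 (ncHomPart a 1 X)) := by
      have : Continuous fun ρ : ℝ => (ρ : ℂ) • ncHomPart a 1 X :=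
        Complex.continuous_ofReal.smul continuous_const
      have h2 := this.tendsto 1
      rw [Complex.ofReal_one, one_smul] at h2
      exact h2.mono_left nhdsWithin_le_nhds
    have h2 := (hc _ hle).tendsto.comp (tendsto_nhdsWithin_iff.2 ⟨h1, hball.mono fun ρ hρ => ?_⟩)
    · exact h2.congr' (hball.mono fun ρ hρ => (hline _ hρ).symm)
    · change ‖(ρ : ℂ) • ncHomPart a 1 X‖ ≤ 1
      exact (smul_mem_ball hle hρ).le
  have hone := hf.boundary n X 0 _ hX hlim
  rw [linFrac_eq_moebius] at hone
  exact (hd.norm_moebius_eq_one_iff hle).1 hone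

theorem IsNCBallMap.norm_linearPart_rankOneTuple_sq {f : NCMap p q r s} (hf : IsNCBallMap f)
    (hp : 0 < p) (hq : 0 < q) {v : Matrix (Fin r) (Fin s) ℂ} (hv : ‖v‖ < 1)
    {a : List (Fin p × Fin q) → Matrix (Fin r) (Fin s) ℂ}
    (ha : IsSchurSeries a fun n X => linFrac v (f n X)) (h0 : a [] = 0) :
    ‖ncHomPart a 1 (rankOneTuple p q)‖ ^ 2 = p * q := by
  have hpos : (0 : ℝ) < p * q := by positivity
  have hn := norm_rankOneTuple_sq (p := p) hq
  set t := ‖rankOneTuple p q‖ with ht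
  have ht0 : t ≠ 0 := by
    rintro h
    rw [h, zero_pow two_ne_zero] at hn
    exact hpos.ne hn
  have hc : ‖((t⁻¹ : ℝ) : ℂ)‖ = t⁻¹ := by
    rw [Complex.norm_real, Real.norm_of_nonneg (inv_nonneg.2 (norm_nonneg _))]
  have h1 := hf.norm_linearPart_eq_one hv ha h0 (X := ((t⁻¹ : ℝ) : ℂ) • rankOneTuple p q)
    (by rw [norm_smul, hc, ← ht, inv_mul_cancel₀ ht0]) fun k l => by
      have h3 : ∀ k, NCMat.entry (((t⁻¹ : ℝ) : ℂ) • rankOneTuple p q) k =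
        ((t⁻¹ : ℝ) : ℂ) • (rankOneTuple p q).entry k := fun _ => rfl
      rw [h3, h3, smul_mul_smul_comm, rankOneTuple_entry_mul, smul_zero]
  rw [ncHomPart_smul, pow_one, norm_smul, hc, inv_mul_eq_one₀ ht0] at h1
  rw [← h1, hn]

end Structure

theorem mainTheorem3 {g' g d' d : ℕ} (hg' : 0 < g') (hg : 0 < g) :
    (∀ f : NCMap g' g d' d, IsNCBallMap f → ‖ncValueZero f‖ ≠ 1 →
      ∃ φ : NCMap g' g d' d,
        (∀ (n : ℕ) (X : NCMat g' g n), ‖X‖ < 1 → f n X = linFrac (ncValueZero f) (φ n X)) ∧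
        (∀ (n : ℕ) (X : NCMat g' g n), ‖X‖ < 1 → φ n X = linFrac (ncValueZero f) (f n X)) ∧
        ∃ (hr : g' ≤ d') (hs : g ≤ d),
          ∃ V ∈ Matrix.unitaryGroup (Fin d') ℂ, ∃ U ∈ Matrix.unitaryGroup (Fin d) ℂ,
          ∃ ψ : NCMap g' g (d' - g') (d - g),
            IsNCAnalyticOnBall ψ ∧ IsContractionValued ψ ∧ ‖ncValueZero ψ‖ < 1 ∧
            ∀ (n : ℕ) (X : NCMat g' g n), ‖X‖ < 1 →
              φ n X = NCMat.const V n * NCMat.blockDiag hr hs X (ψ n X) *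
                NCMat.const U.conjTranspose n) ∧
    (∀ v : Matrix (Fin d') (Fin d) ℂ, ‖v‖ < 1 →
      ∀ (hr : g' ≤ d') (hs : g ≤ d),
      ∀ V ∈ Matrix.unitaryGroup (Fin d') ℂ, ∀ U ∈ Matrix.unitaryGroup (Fin d) ℂ,
      ∀ ψ : NCMap g' g (d' - g') (d - g),
        IsNCAnalyticOnBall ψ → IsContractionValued ψ → ‖ncValueZero ψ‖ < 1 →
        ∀ f : NCMap g' g d' d,
          (∀ (n : ℕ) (X : NCMat g' g n), ‖X‖ < 1 →
            f n X = linFrac v (NCMat.const V n * NCMat.blockDiag hr hs X (ψ n X) *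
              NCMat.const U.conjTranspose n)) →
          IsNCBallMap f ∧ ‖ncValueZero f‖ ≠ 1) := by
  refine ⟨fun f hf hne => ?_, fun v hv hr hs V hV U hU ψ hψ hψc hψ0 f hf => ?_⟩
  · obtain ⟨a₀, ha₀⟩ := exists_isSchurSeries hf.analytic hf.contraction
    have hv : ‖ncValueZero f‖ < 1 := by
      refine lt_of_le_of_ne ?_ hne
      rw [ha₀.ncValueZero_eq]
      exact ha₀.norm_coeff_nil_le
    have hφa := hf.analytic.linFrac_comp hf.contraction hv
    have hφc := hf.contraction.linFrac_comp hv
    obtain ⟨a, ha⟩ := exists_isSchurSeries hφa hφc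
    have h0 : a [] = 0 := by
      refine norm_le_zero_iff.1 ((norm_le_norm_const_one _).trans ?_)
      rw [← ha.map_zero, ha₀.map_zero, ha₀.ncValueZero_eq, linFrac_eq_moebius]
      rw [ha₀.ncValueZero_eq] at hv
      rw [(isDefectPair_linFrac hv 1).moebius_self, norm_zero]
    exact ⟨_, fun n X hX => (linFrac_linFrac hv (hf.contraction n X hX)).symm, fun n X _ => rfl,
      ha.exists_blockDiag hφa h0 hg' hg
        (hf.norm_linearPart_rankOneTuple_sq hg' hg hv ha h0)⟩
  · refine isNCBallMap_linFrac_blockSum hv (isUnitarySplit_of_mem_unitaryGroup hr hV)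
      (isUnitarySplit_of_mem_unitaryGroup hs hU) hψ hψc hψ0 fun n X hX => ?_
    rw [hf n X hX, const_mul_blockDiag_mul_const]
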